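/- Let $\mathbb{D}$ be the open unit disc, let $\operatorname{Hol}(\mathbb{D},\mathbb{D})$ be the set of holomorphic maps $\mathbb{D}\to\mathbb{D}$, with the topology of locally uniform convergence, and let $\operatorname{Aut}(\mathbb{D})$ be the group of conformal automorphisms of $\mathbb{D}$. Let $f\in\operatorname{Hol}(\mathbb{D},\mathbb{D})$ and write $f^n$ for its $n$-th iterate. A map $h\in\operatorname{Hol}(\mathbb{D},\mathbb{D})$ is a \emph{left straightening} of $f$ if $h(0)=0$ and there are $\gamma_n\in\operatorname{Aut}(\mathbb{D})$ with $\gamma_n^{-1}\circ f^n\to h$ locally uniformly on $\mathbb{D}$. A map $f\in\operatorname{Hol}(\mathbb{D},\mathbb{D})\setminus\operatorname{Aut}(\mathbb{D})$ is called \emph{elliptic} if it has a fixed point in $\mathbb{D}$. If it has none, let $\tau_f\in\partial\mathbb{D}$ be its Wolff point (the constant to which $f^n$ converges locally uniformly on $\mathbb{D}$) and $f'(\tau_f)$ its angular derivative at $\tau_f$; then $f$ is \emph{parabolic} if $f'(\tau_f)=1$ and \emph{hyperbolic} if $0<f'(\tau_f)<1$. (So these three terms apply only to maps that are not automorphisms.)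 With $\omega$ the hyperbolic distance of $\mathbb{D}$, the hyperbolic $1$-step of $f$ at $z\in\mathbb{D}$ is $s^f_1(z)=\lim_{n\to\infty}\omega\bigl(f^n(z),f^{n+1}(z)\bigr)$; $f$ has \emph{zero} hyperbolic $1$-step if $s^f_1(z)=0$ for all $z\in\mathbb{D}$, and \emph{positive} hyperbolic $1$-step if $s^f_1(z)>0$ for all $z\in\mathbb{D}$. Then every $f\in\operatorname{Hol}(\mathbb{D},\mathbb{D})$ has a left straightening, and for every left straightening $h$ of $f$ the following hold. (i) $f$ is an automorphism if and only if $h$ is an automorphism. (ii) $f$ is either elliptic, or parabolic with zero hyperbolic $1$-step, if and only if $h$ is constant. (iii) $f$ is either hyperbolic, or parabolic with positive hyperbolic $1$-step, if and only if $h$ is neither constant nor an automorphism. -/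

import Mathlib

open Filter Topology

noncomputable section

/-- The open unit disc `𝔻` of the complex plane. Self-maps of the disc are represented by functions
`ℂ → ℂ`, of which only the restriction to the disc is ever used. -/
def unitDisc : Set ℂ := Metric.ball 0 1

/-- `f ∈ Hol(𝔻, 𝔻)`. -/
structure IsHolSelfMap (f : ℂ → ℂ) : Prop where
  differentiableOn : DifferentiableOn ℂ f unitDisc
  mapsTo : Set.MapsTo f unitDisc unitDisc

/-- `f ∈ Aut(𝔻)`: a holomorphic bijection of the disc onto itself. -/
structure IsDiscAut (f : ℂ → ℂ) : Prop where
  isHolSelfMap : IsHolSelfMap f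
  bijOn : Set.BijOn f unitDisc unitDisc

/-- `f` is constant on the disc. -/
def IsConstOnDisc (f : ℂ → ℂ) : Prop := ∃ c : ℂ, ∀ z ∈ unitDisc, f z = c

/-- `h` is a left straightening of `f`: it is a holomorphic self-map of the disc with `h 0 = 0`, and
there are automorphisms `γ n` of the disc with `(γ n)⁻¹ ∘ fⁿ → h` locally uniformly on the disc. -/
structure IsLeftStraightening (f h : ℂ → ℂ) : Prop where
  isHolSelfMap : IsHolSelfMap h
  map_zero : h 0 = 0
  exists_aut : ∃ γ : ℕ → ℂ → ℂ, (∀ n, IsDiscAut (γ n)) ∧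
    TendstoLocallyUniformlyOn (fun n => Function.invFunOn (γ n) unitDisc ∘ f^[n]) h atTop unitDisc

/-- The hyperbolic distance `ω(z, w)` of the disc, normalised so that
`ω(z, w) = (1/2) log ((1 + ρ) / (1 - ρ))` with `ρ = |z - w| / |1 - conj w * z|`. -/
def hypDist (z w : ℂ) : ℝ :=
  let ρ : ℝ := ‖z - w‖ / ‖1 - (starRingEnd ℂ) w * z‖
  1 / 2 * Real.log ((1 + ρ) / (1 - ρ))

/-- The hyperbolic `μ`-step of `f` at `z` exists and equals `s`:
`ω(f^n(z), f^(n+μ)(z)) → s` as `n → ∞`. -/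
def HasHypStep (f : ℂ → ℂ) (μ : ℕ) (z : ℂ) (s : ℝ) : Prop :=
  Tendsto (fun n : ℕ => hypDist (f^[n] z) (f^[n + μ] z)) atTop (𝓝 s)

/-- Zero hyperbolic `1`-step: the step vanishes identically on the disc. -/
def HasZeroHypStep (f : ℂ → ℂ) : Prop := ∀ z ∈ unitDisc, HasHypStep f 1 z 0

/-- Positive hyperbolic `1`-step: the step is positive at every point of the disc. -/
def HasPosHypStep (f : ℂ → ℂ) : Prop := ∀ z ∈ unitDisc, ∃ s : ℝ, 0 < s ∧ HasHypStep f 1 z s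

/-- The Stolz region with vertex `τ` and amplitude `M`. -/
def stolzRegion (τ : ℂ) (M : ℝ) : Set ℂ := {z | z ∈ unitDisc ∧ ‖τ - z‖ < M * (1 - ‖z‖)}

/-- `F` has angular (non-tangential) limit `l` at the boundary point `τ`. -/
def HasAngularLimit (F : ℂ → ℂ) (τ l : ℂ) : Prop :=
  ∀ M : ℝ, 1 < M → Tendsto F (𝓝[stolzRegion τ M] τ) (𝓝 l)

/-- `f` has angular derivative `d` at the boundary point `τ`: it has an angular limit `σ` at `τ` and
the difference quotient `(f z - σ) / (z - τ)` has angular limit `d` at `τ`. -/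
def HasAngularDeriv (f : ℂ → ℂ) (τ d : ℂ) : Prop :=
  ∃ σ : ℂ, HasAngularLimit f τ σ ∧ HasAngularLimit (fun z => (f z - σ) / (z - τ)) τ d

/-- `τ` is the Wolff point of a map `f` without fixed points in the disc: the point of the unit
circle to which the iterates of `f` converge locally uniformly on the disc. -/
def IsWolffPoint (f : ℂ → ℂ) (τ : ℂ) : Prop :=
  ‖τ‖ = 1 ∧ TendstoLocallyUniformlyOn (fun n => f^[n]) (fun _ => τ) atTop unitDisc

/-- `f` (not an automorphism) is elliptic: it has a fixed point in the disc. -/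
def IsEllipticMap (f : ℂ → ℂ) : Prop :=
  IsHolSelfMap f ∧ ¬ IsDiscAut f ∧ ∃ z ∈ unitDisc, f z = z

/-- `f` (not an automorphism) is parabolic: it has no fixed point in the disc, and its angular
derivative at its Wolff point is `1`. -/
def IsParabolicMap (f : ℂ → ℂ) : Prop :=
  IsHolSelfMap f ∧ ¬ IsDiscAut f ∧ (∀ z ∈ unitDisc, f z ≠ z) ∧
    ∃ τ : ℂ, IsWolffPoint f τ ∧ HasAngularDeriv f τ 1

/-- `f` (not an automorphism) is hyperbolic: it has no fixed point in the disc, and its angular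
derivative at its Wolff point is a real number in `(0, 1)`. -/
def IsHyperbolicMap (f : ℂ → ℂ) : Prop :=
  IsHolSelfMap f ∧ ¬ IsDiscAut f ∧ (∀ z ∈ unitDisc, f z ≠ z) ∧
    ∃ τ : ℂ, IsWolffPoint f τ ∧ ∃ d : ℝ, 0 < d ∧ d < 1 ∧ HasAngularDeriv f τ (d : ℂ)

end

/-! By Schwarz–Pick, `pdist (f^[n] z) (f^[n] w)` decreases with `n`. Automorphisms preserve `pdist`,
so for every left straightening `h` the limit is `pdist (h z) (h w)`
(`IsLeftStraightening.tendsto_pdist`). Thus `h` records the limiting distances between orbits, and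
the three equivalences are read off from these.

Existence: move `f^[n] 0` to `0`. If all orbits approach that of `0`, the limit is `0`. Otherwise
rotate so that a point `z₀` with positive limiting distance goes to a positive number `u n`. Passing
from stage `n` to stage `m` composes with a self-map that fixes `0` and sends `u n` to `u m`; as `u
m / u n` is close to `1`, this map is close to the identity (`IsHolSelfMap.norm_sub_self_le`), so
the sequence is Cauchy.

Equality in Schwarz–Pick characterises automorphisms, which gives (i). It also forces all orbits of
a non-automorphism with a fixed point to accumulate only there, so `h` is constant.

Without fixed points, a Hurwitz argument (`IsLeftStraightening.apply_ne`) shows that a non-constant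
`h` satisfies `h (f z) ≠ h z` everywhere. Since the step at `z` is `hypDist (h z) (h (f z))`, it
vanishes identically when `h` is constant and is positive everywhere otherwise. The type of `f`
comes from Wolff's lemma and the Julia–Wolff–Carathéodory theorem: the angular derivative at the
Wolff point is `1 / c`, with `c ≥ 1` the best constant in `c * horo τ (f z) ≤ horo τ z`. If `c > 1`,
Harnack's inequality keeps consecutive orbit points at `pdist` at least `(c - 1) / (c + 1)`, so `h`
is not constant. -/

open scoped ComplexConjugate

/-! ### Pseudo-hyperbolic distance and the involutions of the disc -/

/-- The pseudo-hyperbolic distance of the disc. -/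
noncomputable def pdist (z w : ℂ) : ℝ := ‖z - w‖ / ‖1 - conj w * z‖

/-- The involutive automorphism of the disc that exchanges `0` and `a`. -/
noncomputable def discInv (a z : ℂ) : ℂ := (a - z) / (1 - conj a * z)

theorem mem_unitDisc {z : ℂ} : z ∈ unitDisc ↔ ‖z‖ < 1 := by simp [unitDisc]

theorem isOpen_unitDisc : IsOpen unitDisc := Metric.isOpen_ball

theorem zero_mem_unitDisc : (0 : ℂ) ∈ unitDisc := by simp [unitDisc]

theorem one_sub_conj_mul_ne_zero {a z : ℂ} (ha : ‖a‖ < 1) (hz : ‖z‖ ≤ 1) :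
    1 - conj a * z ≠ 0 := by
  intro h
  have h1 : ‖conj a * z‖ = 1 := by rw [← sub_eq_zero.mp h, norm_one]
  rw [norm_mul, RCLike.norm_conj] at h1
  nlinarith [norm_nonneg a, norm_nonneg z]

theorem sq_norm_one_sub_conj_mul (a z : ℂ) :
    ‖1 - conj a * z‖ ^ 2 = ‖a - z‖ ^ 2 + (1 - ‖a‖ ^ 2) * (1 - ‖z‖ ^ 2) := by
  simp only [← Complex.normSq_eq_norm_sq, Complex.normSq_apply]
  simp
  ring

theorem norm_one_sub_conj_mul_comm (a z : ℂ) : ‖1 - conj a * z‖ = ‖1 - conj z * a‖ := by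
  rw [← RCLike.norm_conj (1 - conj a * z)]
  simp [mul_comm]

theorem pdist_comm (z w : ℂ) : pdist z w = pdist w z := by
  rw [pdist, pdist, norm_sub_rev, norm_one_sub_conj_mul_comm]

theorem pdist_nonneg (z w : ℂ) : 0 ≤ pdist z w := by unfold pdist; positivity

@[simp] theorem pdist_self (z : ℂ) : pdist z z = 0 := by simp [pdist]

@[simp] theorem pdist_zero_right (z : ℂ) : pdist z 0 = ‖z‖ := by simp [pdist]

theorem norm_discInv (a z : ℂ) : ‖discInv a z‖ = pdist z a := by
  rw [discInv, norm_div, pdist, norm_sub_rev]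

theorem one_sub_sq_pdist {z w : ℂ} (hz : z ∈ unitDisc) (hw : w ∈ unitDisc) :
    1 - pdist z w ^ 2 = (1 - ‖z‖ ^ 2) * (1 - ‖w‖ ^ 2) / ‖1 - conj w * z‖ ^ 2 := by
  have h := norm_ne_zero_iff.mpr
    (one_sub_conj_mul_ne_zero (mem_unitDisc.mp hw) (mem_unitDisc.mp hz).le)
  have h2 := sq_norm_one_sub_conj_mul w z
  rw [pdist, norm_sub_rev z w, div_pow, eq_div_iff (pow_ne_zero 2 h), sub_mul,
    div_mul_cancel₀ _ (pow_ne_zero 2 h)]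
  linarith

theorem one_sub_sq_norm_pos {z : ℂ} (hz : z ∈ unitDisc) : 0 < 1 - ‖z‖ ^ 2 := by
  have := mem_unitDisc.mp hz
  nlinarith [norm_nonneg z]

theorem norm_one_sub_conj_mul_pos {z w : ℂ} (hz : z ∈ unitDisc) (hw : w ∈ unitDisc) :
    0 < ‖1 - conj w * z‖ :=
  norm_pos_iff.mpr (one_sub_conj_mul_ne_zero (mem_unitDisc.mp hw) (mem_unitDisc.mp hz).le)

theorem pdist_lt_one {z w : ℂ} (hz : z ∈ unitDisc) (hw : w ∈ unitDisc) : pdist z w < 1 := by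
  have h := one_sub_sq_pdist hz hw
  have h1 := norm_one_sub_conj_mul_pos hz hw
  have h2 := one_sub_sq_norm_pos hz
  have h3 := one_sub_sq_norm_pos hw
  have : 0 < 1 - pdist z w ^ 2 := by rw [h]; positivity
  nlinarith [pdist_nonneg z w]

theorem pdist_eq_zero {z w : ℂ} (hz : z ∈ unitDisc) (hw : w ∈ unitDisc) :
    pdist z w = 0 ↔ z = w := by
  have h := (norm_one_sub_conj_mul_pos hz hw).ne'
  simp [pdist, div_eq_zero_iff, h, sub_eq_zero]

theorem mapsTo_discInv {a : ℂ} (ha : a ∈ unitDisc) :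
    Set.MapsTo (discInv a) unitDisc unitDisc := fun z hz => by
  rw [mem_unitDisc, norm_discInv]
  exact pdist_lt_one hz ha

theorem discInv_discInv {a z : ℂ} (ha : a ∈ unitDisc) (hz : z ∈ unitDisc) :
    discInv a (discInv a z) = z := by
  have h := one_sub_conj_mul_ne_zero (mem_unitDisc.mp ha) (mem_unitDisc.mp hz).le
  have h2 := one_sub_conj_mul_ne_zero (mem_unitDisc.mp ha) (mem_unitDisc.mp ha).le
  have h3 := one_sub_conj_mul_ne_zero (mem_unitDisc.mp ha)
    (mem_unitDisc.mp (mapsTo_discInv ha hz)).le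
  have h4 : discInv a z * (1 - conj a * z) = a - z := div_mul_cancel₀ _ h
  rw [discInv, div_eq_iff h3]
  apply mul_right_cancel₀ h
  linear_combination (z * conj a - 1) * h4

@[simp] theorem discInv_self (a : ℂ) : discInv a a = 0 := by simp [discInv]

@[simp] theorem discInv_zero (a : ℂ) : discInv a 0 = a := by simp [discInv]

theorem differentiableOn_discInv {a : ℂ} (ha : a ∈ unitDisc) :
    DifferentiableOn ℂ (discInv a) unitDisc := by
  unfold discInv
  refine DifferentiableOn.div (by fun_prop) (by fun_prop) fun z hz =>
    one_sub_conj_mul_ne_zero (mem_unitDisc.mp ha) (mem_unitDisc.mp hz).le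

/-! ### Self-maps, automorphisms and the Schwarz–Pick lemma -/

theorem isHolSelfMap_discInv {a : ℂ} (ha : a ∈ unitDisc) : IsHolSelfMap (discInv a) :=
  ⟨differentiableOn_discInv ha, mapsTo_discInv ha⟩

theorem IsHolSelfMap.comp {f g : ℂ → ℂ} (hf : IsHolSelfMap f) (hg : IsHolSelfMap g) :
    IsHolSelfMap (f ∘ g) :=
  ⟨hf.differentiableOn.comp hg.differentiableOn hg.mapsTo, hf.mapsTo.comp hg.mapsTo⟩

theorem isHolSelfMap_id : IsHolSelfMap id := ⟨differentiableOn_id, Set.mapsTo_id _⟩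

theorem IsHolSelfMap.iterate {f : ℂ → ℂ} (hf : IsHolSelfMap f) (n : ℕ) :
    IsHolSelfMap f^[n] := by
  induction n with
  | zero => exact isHolSelfMap_id
  | succ n ih => rw [Function.iterate_succ]; exact ih.comp hf

theorem isHolSelfMap_const_mul {c : ℂ} (hc : ‖c‖ ≤ 1) : IsHolSelfMap (fun z => c * z) := by
  refine ⟨by fun_prop, fun z hz => ?_⟩
  rw [mem_unitDisc] at *
  rw [norm_mul]
  nlinarith [norm_nonneg z]

theorem IsHolSelfMap.isDiscAut {f g : ℂ → ℂ} (hf : IsHolSelfMap f) (hg : IsHolSelfMap g)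
    (hfg : ∀ z ∈ unitDisc, f (g z) = z) (hgf : ∀ z ∈ unitDisc, g (f z) = z) : IsDiscAut f :=
  ⟨hf, Set.InvOn.bijOn ⟨hgf, hfg⟩ hf.mapsTo hg.mapsTo⟩

theorem isDiscAut_discInv {a : ℂ} (ha : a ∈ unitDisc) : IsDiscAut (discInv a) :=
  (isHolSelfMap_discInv ha).isDiscAut (isHolSelfMap_discInv ha)
    (fun _ hz => discInv_discInv ha hz) (fun _ hz => discInv_discInv ha hz)

theorem IsDiscAut.comp {f g : ℂ → ℂ} (hf : IsDiscAut f) (hg : IsDiscAut g) :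
    IsDiscAut (f ∘ g) :=
  ⟨hf.isHolSelfMap.comp hg.isHolSelfMap, hf.bijOn.comp hg.bijOn⟩

theorem conj_mul_self_of_norm_one {c : ℂ} (hc : ‖c‖ = 1) : conj c * c = 1 := by
  rw [← Complex.normSq_eq_conj_mul_self, Complex.normSq_eq_norm_sq, hc]; simp

theorem isDiscAut_const_mul {c : ℂ} (hc : ‖c‖ = 1) : IsDiscAut (fun z => c * z) := by
  have h := conj_mul_self_of_norm_one hc
  refine (isHolSelfMap_const_mul hc.le).isDiscAut
    (isHolSelfMap_const_mul (c := conj c) (by simp [hc])) (fun z _ => ?_) (fun z _ => ?_)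
  · linear_combination z * h
  · linear_combination z * h

theorem IsDiscAut.congr {f g : ℂ → ℂ} (hf : IsDiscAut f) (h : Set.EqOn g f unitDisc) :
    IsDiscAut g :=
  ⟨⟨hf.isHolSelfMap.differentiableOn.congr h, hf.isHolSelfMap.mapsTo.congr h.symm⟩,
    hf.bijOn.congr h.symm⟩

theorem IsHolSelfMap.norm_le {g : ℂ → ℂ} (hg : IsHolSelfMap g) (h0 : g 0 = 0) {z : ℂ}
    (hz : z ∈ unitDisc) : ‖g z‖ ≤ ‖z‖ :=
  Complex.norm_le_norm_of_mapsTo_ball hg.differentiableOn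
    (hg.mapsTo.mono_right Metric.ball_subset_closedBall) h0 (mem_unitDisc.mp hz)

theorem IsHolSelfMap.eq_const_mul {g : ℂ → ℂ} (hg : IsHolSelfMap g) (h0 : g 0 = 0) {z : ℂ}
    (hz : z ∈ unitDisc) (hz0 : z ≠ 0) (h : ‖g z‖ = ‖z‖) :
    ∃ c : ℂ, ‖c‖ = 1 ∧ ∀ w ∈ unitDisc, g w = c * w := by
  have hm : Set.MapsTo g (Metric.ball 0 1) (Metric.closedBall (g 0) 1) := by
    rw [h0]; exact hg.mapsTo.mono_right Metric.ball_subset_closedBall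
  obtain ⟨c, hc, hcg⟩ := Complex.affine_of_mapsTo_ball_of_exists_norm_dslope_eq_div'
    hg.differentiableOn hm ⟨z, hz, by
      rw [dslope_of_ne _ hz0, slope_def_field, h0, sub_zero, sub_zero, norm_div, h,
        div_self (norm_ne_zero_iff.mpr hz0), div_one]⟩
  refine ⟨c, by simpa using hc, fun w hw => ?_⟩
  rw [hcg hw]
  simp [h0, mul_comm]

/-- The Schwarz–Pick lemma. -/
theorem IsHolSelfMap.pdist_le {f : ℂ → ℂ} (hf : IsHolSelfMap f) {z w : ℂ} (hz : z ∈ unitDisc)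
    (hw : w ∈ unitDisc) : pdist (f z) (f w) ≤ pdist z w := by
  have hg := (isHolSelfMap_discInv (hf.mapsTo hw)).comp (hf.comp (isHolSelfMap_discInv hw))
  have h := hg.norm_le (by simp) (mapsTo_discInv hw hz)
  simpa [discInv_discInv hw hz, norm_discInv] using h

/-- The equality case of Schwarz–Pick: moving `w` and `f w` to `0` by involutions reduces it to the
equality case of the Schwarz lemma, where the map is a rotation. -/
theorem IsHolSelfMap.isDiscAut_of_pdist_eq {f : ℂ → ℂ} (hf : IsHolSelfMap f) {z w : ℂ}
    (hz : z ∈ unitDisc) (hw : w ∈ unitDisc) (hzw : z ≠ w) (h : pdist (f z) (f w) = pdist z w) :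
    IsDiscAut f := by
  have hg := (isHolSelfMap_discInv (hf.mapsTo hw)).comp (hf.comp (isHolSelfMap_discInv hw))
  obtain ⟨c, hc, hcg⟩ := hg.eq_const_mul (by simp) (mapsTo_discInv hw hz)
    (by rw [← norm_ne_zero_iff, norm_discInv]; exact (pdist_eq_zero hz hw).not.mpr hzw)
    (by simpa [discInv_discInv hw hz, norm_discInv] using h)
  refine ((isDiscAut_discInv (hf.mapsTo hw)).comp
    ((isDiscAut_const_mul hc).comp (isDiscAut_discInv hw))).congr fun u hu => ?_
  have := hcg _ (mapsTo_discInv hw hu)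
  simp only [Function.comp_apply, discInv_discInv hw hu] at this ⊢
  rw [← this, discInv_discInv (hf.mapsTo hw) (hf.mapsTo hu)]

/-! ### Inverses of automorphisms -/

theorem IsDiscAut.invFunOn_mem {γ : ℂ → ℂ} (h : IsDiscAut γ) {w : ℂ} (hw : w ∈ unitDisc) :
    Function.invFunOn γ unitDisc w ∈ unitDisc :=
  Function.invFunOn_mem (h.bijOn.surjOn hw)

theorem IsDiscAut.apply_invFunOn {γ : ℂ → ℂ} (h : IsDiscAut γ) {w : ℂ} (hw : w ∈ unitDisc) :
    γ (Function.invFunOn γ unitDisc w) = w :=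
  Function.invFunOn_eq (h.bijOn.surjOn hw)

theorem IsDiscAut.invFunOn_apply {γ : ℂ → ℂ} (h : IsDiscAut γ) {z : ℂ} (hz : z ∈ unitDisc) :
    Function.invFunOn γ unitDisc (γ z) = z :=
  h.bijOn.invOn_invFunOn.1 hz

theorem IsDiscAut.tendsto_invFunOn {γ : ℂ → ℂ} (h : IsDiscAut γ) {z : ℂ} (hz : z ∈ unitDisc) :
    Tendsto (Function.invFunOn γ unitDisc) (𝓝 (γ z)) (𝓝 z) := by
  have hzn : unitDisc ∈ 𝓝 z := isOpen_unitDisc.mem_nhds hz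
  have han : AnalyticAt ℂ γ z := h.isHolSelfMap.differentiableOn.analyticAt hzn
  have hle : 𝓝 (γ z) ≤ map γ (𝓝 z) := by
    refine han.eventually_constant_or_nhds_le_map_nhds.resolve_left fun hc => ?_
    have h1 : ∀ᶠ w in 𝓝[≠] z, w = z := by
      filter_upwards [nhdsWithin_le_nhds hc, nhdsWithin_le_nhds hzn] with w hw1 hw2
      exact h.bijOn.injOn hw2 hz hw1
    obtain ⟨w, hw1, hw2⟩ := (h1.and self_mem_nhdsWithin).exists
    exact hw2 hw1
  refine (map_mono hle).trans ?_
  rw [map_map]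
  refine (tendsto_id (x := 𝓝 z)).congr' ?_
  filter_upwards [hzn] with w hw
  exact (h.invFunOn_apply hw).symm

/-- The open mapping theorem makes the inverse continuous. Critical points of the injective map `γ`
are isolated, so near `γ z` the inverse is differentiable off `γ z` itself, and a continuous
isolated singularity is removable. -/
theorem IsDiscAut.isHolSelfMap_invFunOn {γ : ℂ → ℂ} (h : IsDiscAut γ) :
    IsHolSelfMap (Function.invFunOn γ unitDisc) := by
  set ψ := Function.invFunOn γ unitDisc with hψ
  refine ⟨fun w hw => ?_, fun w hw => h.invFunOn_mem hw⟩
  obtain ⟨z, hz, rfl⟩ := h.bijOn.surjOn hw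
  have hzn : unitDisc ∈ 𝓝 z := isOpen_unitDisc.mem_nhds hz
  have han : AnalyticAt ℂ γ z := h.isHolSelfMap.differentiableOn.analyticAt hzn
  have hd : ∀ᶠ u in 𝓝[≠] z, deriv γ u ≠ 0 := by
    refine (han.deriv.eventually_eq_zero_or_eventually_ne_zero).resolve_left fun hc => ?_
    obtain ⟨ε, hε, hB⟩ := Metric.eventually_nhds_iff_ball.mp (hc.and hzn)
    have hconst : ∀ u ∈ Metric.ball z ε, γ u = γ z := fun u hu => by
      refine (convex_ball z ε).is_const_of_fderivWithin_eq_zero (𝕜 := ℂ)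
        (h.isHolSelfMap.differentiableOn.mono fun v hv => (hB v hv).2) (fun v hv => ?_) hu
        (Metric.mem_ball_self hε)
      rw [fderivWithin_of_isOpen Metric.isOpen_ball hv]
      ext
      simpa using (hB v hv).1
    have h1 : ∀ᶠ w in 𝓝[≠] z, w = z := by
      filter_upwards [nhdsWithin_le_nhds (Metric.ball_mem_nhds z hε)] with u hu
      exact h.bijOn.injOn (hB u hu).2 hz (hconst u hu)
    obtain ⟨w, hw1, hw2⟩ := (h1.and self_mem_nhdsWithin).exists
    exact hw2 hw1
  have hψz : ψ (γ z) = z := h.invFunOn_apply hz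
  have hcont : ContinuousAt ψ (γ z) := by
    rw [ContinuousAt, hψz]; exact h.tendsto_invFunOn hz
  refine (Complex.analyticAt_of_differentiable_on_punctured_nhds_of_continuousAt ?_
    hcont).differentiableAt.differentiableWithinAt
  have hwn : unitDisc ∈ 𝓝 (γ z) := isOpen_unitDisc.mem_nhds hw
  have hev : ∀ᶠ v in 𝓝[≠] (γ z), ψ v ∈ ({z}ᶜ : Set ℂ) := by
    filter_upwards [nhdsWithin_le_nhds hwn, self_mem_nhdsWithin] with v hv hne hvz
    apply hne
    rw [Set.mem_singleton_iff] at hvz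
    rw [← h.apply_invFunOn hv, ← hψ, hvz]; rfl
  have ht : Tendsto ψ (𝓝[≠] (γ z)) (𝓝[≠] z) :=
    tendsto_nhdsWithin_iff.mpr ⟨(h.tendsto_invFunOn hz).mono_left nhdsWithin_le_nhds, hev⟩
  filter_upwards [ht hd, nhdsWithin_le_nhds hwn] with v hv hvD
  have hvψ := h.invFunOn_mem hvD
  have h2 : HasDerivAt γ (deriv γ (ψ v)) (ψ v) :=
    (h.isHolSelfMap.differentiableOn.differentiableAt
      (isOpen_unitDisc.mem_nhds hvψ)).hasDerivAt
  have h3 : ContinuousAt ψ v := by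
    have := h.tendsto_invFunOn hvψ
    rwa [h.apply_invFunOn hvD] at this
  refine (HasDerivAt.of_local_left_inverse h3 h2 hv ?_).differentiableAt
  filter_upwards [isOpen_unitDisc.mem_nhds hvD] with u hu
  exact h.apply_invFunOn hu

theorem IsDiscAut.pdist_eq {γ : ℂ → ℂ} (h : IsDiscAut γ) {z w : ℂ} (hz : z ∈ unitDisc)
    (hw : w ∈ unitDisc) : pdist (γ z) (γ w) = pdist z w := by
  refine le_antisymm (h.isHolSelfMap.pdist_le hz hw) ?_
  have := h.isHolSelfMap_invFunOn.pdist_le (h.isHolSelfMap.mapsTo hz) (h.isHolSelfMap.mapsTo hw)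
  rwa [h.invFunOn_apply hz, h.invFunOn_apply hw] at this

theorem IsDiscAut.pdist_invFunOn {γ : ℂ → ℂ} (h : IsDiscAut γ) {z w : ℂ} (hz : z ∈ unitDisc)
    (hw : w ∈ unitDisc) : pdist (Function.invFunOn γ unitDisc z)
      (Function.invFunOn γ unitDisc w) = pdist z w := by
  rw [← h.pdist_eq (h.invFunOn_mem hz) (h.invFunOn_mem hw), h.apply_invFunOn hz,
    h.apply_invFunOn hw]

/-! ### Euclidean estimates and locally uniform convergence -/

theorem norm_sub_le_two_mul_pdist {z w : ℂ} (hz : z ∈ unitDisc) (hw : w ∈ unitDisc) :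
    ‖z - w‖ ≤ 2 * pdist z w := by
  have h := norm_one_sub_conj_mul_pos hz hw
  have h2 : ‖1 - conj w * z‖ ≤ 2 := by
    refine (norm_sub_le _ _).trans ?_
    rw [norm_mul, RCLike.norm_conj, norm_one]
    have := mem_unitDisc.mp hz
    have := mem_unitDisc.mp hw
    nlinarith [norm_nonneg z, norm_nonneg w]
  rw [pdist, mul_div_assoc', le_div_iff₀ h]
  nlinarith [norm_nonneg (z - w)]

/-- Pseudo-hyperbolic discs shrink in Euclidean size near the circle: write `1 - conj w * z` as `(1
- ‖w‖ ^ 2) - conj w * (z - w)` and solve for `‖z - w‖`. -/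
theorem norm_sub_le_of_pdist_le {z w : ℂ} {r : ℝ} (hz : z ∈ unitDisc) (hw : w ∈ unitDisc)
    (hr : r < 1) (h : pdist z w ≤ r) : ‖z - w‖ ≤ r / (1 - r) * (1 - ‖w‖ ^ 2) := by
  have hpos := norm_one_sub_conj_mul_pos hz hw
  have hr0 : 0 ≤ r := (pdist_nonneg z w).trans h
  rw [pdist, div_le_iff₀ hpos] at h
  have h1 : 1 - conj w * z = ((1 - ‖w‖ ^ 2 : ℝ) : ℂ) - conj w * (z - w) := by
    have : conj w * w = ((‖w‖ ^ 2 : ℝ) : ℂ) := by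
      rw [← Complex.normSq_eq_conj_mul_self, Complex.normSq_eq_norm_sq]
    push_cast at this ⊢
    linear_combination -this
  have h2 : ‖1 - conj w * z‖ ≤ (1 - ‖w‖ ^ 2) + ‖z - w‖ := by
    rw [h1]
    refine (norm_sub_le _ _).trans ?_
    rw [Complex.norm_real, Real.norm_of_nonneg (one_sub_sq_norm_pos hw).le, norm_mul,
      RCLike.norm_conj]
    have := mem_unitDisc.mp hw
    nlinarith [norm_nonneg (z - w)]
  have h3 : 0 < 1 - r := by linarith
  rw [div_mul_eq_mul_div, le_div_iff₀ h3]
  nlinarith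

theorem tendsto_pdist {ι : Type*} {l : Filter ι} {u v : ι → ℂ} {a b : ℂ} (hu : Tendsto u l (𝓝 a))
    (hv : Tendsto v l (𝓝 b)) (ha : a ∈ unitDisc) (hb : b ∈ unitDisc) :
    Tendsto (fun n => pdist (u n) (v n)) l (𝓝 (pdist a b)) := by
  unfold pdist
  refine Tendsto.div (hu.sub hv).norm ?_ (norm_one_sub_conj_mul_pos ha hb).ne'
  exact (tendsto_const_nhds.sub (((Complex.continuous_conj.tendsto b).comp hv).mul hu)).norm

/-- Schwarz–Pick gives all self-maps the common modulus of continuity `2 * pdist`, and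
equicontinuity upgrades pointwise convergence. -/
theorem tendstoLocallyUniformlyOn_of_isHolSelfMap {F : ℕ → ℂ → ℂ} {h : ℂ → ℂ}
    (hF : ∀ n, IsHolSelfMap (F n))
    (hlim : ∀ z ∈ unitDisc, Tendsto (fun n => F n z) atTop (𝓝 (h z))) :
    TendstoLocallyUniformlyOn F h atTop unitDisc := by
  have key : ∀ n, ∀ y ∈ unitDisc, ∀ x ∈ unitDisc, ‖F n y - F n x‖ ≤ 2 * pdist y x :=
    fun n y hy x hx => (norm_sub_le_two_mul_pdist ((hF n).mapsTo hy) ((hF n).mapsTo hx)).trans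
      (by linarith [(hF n).pdist_le hy hx])
  have key' : ∀ y ∈ unitDisc, ∀ x ∈ unitDisc, ‖h y - h x‖ ≤ 2 * pdist y x := fun y hy x hx =>
    le_of_tendsto ((hlim y hy).sub (hlim x hx)).norm (Eventually.of_forall fun n => key n y hy x hx)
  rw [Metric.tendstoLocallyUniformlyOn_iff]
  intro ε hε x hx
  have h1 : Tendsto (fun y => pdist y x) (𝓝[unitDisc] x) (𝓝 0) := by
    have := tendsto_pdist (l := 𝓝[unitDisc] x) (u := id) (v := fun _ => x)
      (tendsto_id.mono_left nhdsWithin_le_nhds) tendsto_const_nhds hx hx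
    rwa [pdist_self] at this
  refine ⟨_, (h1.eventually_lt_const (show 0 < ε / 8 by positivity)).and self_mem_nhdsWithin, ?_⟩
  filter_upwards [(Metric.tendsto_nhds.mp (hlim x hx)) (ε / 4) (by positivity)] with n hn y hy
  rw [dist_eq_norm] at *
  have e : h y - F n y = (h y - h x) - (F n y - F n x) - (F n x - h x) := by ring
  rw [e]
  have h2 := key n y hy.2 x hx
  have h3 := key' y hy.2 x hx
  have h4 : pdist y x < ε / 8 := hy.1
  have h5 := norm_sub_le ((h y - h x) - (F n y - F n x)) (F n x - h x)
  have h6 := norm_sub_le (h y - h x) (F n y - F n x)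
  linarith

/-! ### Limiting distances between orbits -/

theorem IsHolSelfMap.antitone_pdist_iterate {f : ℂ → ℂ} (hf : IsHolSelfMap f) {z w : ℂ}
    (hz : z ∈ unitDisc) (hw : w ∈ unitDisc) :
    Antitone (fun n => pdist (f^[n] z) (f^[n] w)) := by
  refine antitone_nat_of_succ_le fun n => ?_
  rw [Function.iterate_succ_apply', Function.iterate_succ_apply']
  exact hf.pdist_le ((hf.iterate n).mapsTo hz) ((hf.iterate n).mapsTo hw)

theorem IsHolSelfMap.tendsto_pdist_iterate {f : ℂ → ℂ} (hf : IsHolSelfMap f) {z w : ℂ}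
    (hz : z ∈ unitDisc) (hw : w ∈ unitDisc) :
    ∃ s, Tendsto (fun n => pdist (f^[n] z) (f^[n] w)) atTop (𝓝 s) ∧
      ∀ n, s ≤ pdist (f^[n] z) (f^[n] w) := by
  have ha := hf.antitone_pdist_iterate hz hw
  have hb : BddBelow (Set.range fun n => pdist (f^[n] z) (f^[n] w)) :=
    ⟨0, by rintro _ ⟨n, rfl⟩; exact pdist_nonneg _ _⟩
  exact ⟨_, tendsto_atTop_ciInf ha hb, fun n => ciInf_le hb n⟩

theorem IsLeftStraightening.tendsto_pdist {f h : ℂ → ℂ} (hf : IsHolSelfMap f)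
    (hh : IsLeftStraightening f h) {z w : ℂ} (hz : z ∈ unitDisc) (hw : w ∈ unitDisc) :
    Tendsto (fun n => pdist (f^[n] z) (f^[n] w)) atTop (𝓝 (pdist (h z) (h w))) := by
  obtain ⟨γ, hγ, hlim⟩ := hh.exists_aut
  refine (_root_.tendsto_pdist (hlim.tendsto_at hz) (hlim.tendsto_at hw)
    (hh.isHolSelfMap.mapsTo hz) (hh.isHolSelfMap.mapsTo hw)).congr fun n => ?_
  exact (hγ n).pdist_invFunOn ((hf.iterate n).mapsTo hz) ((hf.iterate n).mapsTo hw)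

/-- Replacing `z, w` by `f z, f w` only shifts by one the sequence whose limit defines the
right-hand side. -/
theorem IsLeftStraightening.pdist_apply {f h : ℂ → ℂ} (hf : IsHolSelfMap f)
    (hh : IsLeftStraightening f h) {z w : ℂ} (hz : z ∈ unitDisc) (hw : w ∈ unitDisc) :
    pdist (h (f z)) (h (f w)) = pdist (h z) (h w) := by
  refine tendsto_nhds_unique (hh.tendsto_pdist hf (hf.mapsTo hz) (hf.mapsTo hw)) ?_
  have h1 := (tendsto_add_atTop_iff_nat 1).mpr (hh.tendsto_pdist hf hz hw)
  simpa only [Function.iterate_succ_apply] using h1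

theorem IsLeftStraightening.pdist_iterate {f h : ℂ → ℂ} (hf : IsHolSelfMap f)
    (hh : IsLeftStraightening f h) {z w : ℂ} (hz : z ∈ unitDisc) (hw : w ∈ unitDisc) (n : ℕ) :
    pdist (h (f^[n] z)) (h (f^[n] w)) = pdist (h z) (h w) := by
  induction n with
  | zero => rfl
  | succ n ih =>
    rw [Function.iterate_succ_apply', Function.iterate_succ_apply', ← ih]
    exact hh.pdist_apply hf ((hf.iterate n).mapsTo hz) ((hf.iterate n).mapsTo hw)

theorem isPreconnected_unitDisc : IsPreconnected unitDisc :=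
  (convex_ball (0 : ℂ) 1).isPreconnected

theorem IsHolSelfMap.analyticOnNhd {f : ℂ → ℂ} (hf : IsHolSelfMap f) :
    AnalyticOnNhd ℂ f unitDisc :=
  hf.differentiableOn.analyticOnNhd isOpen_unitDisc

theorem IsHolSelfMap.eqOn_const {f : ℂ → ℂ} (hf : IsHolSelfMap f) {z c : ℂ} (hz : z ∈ unitDisc)
    (h : ∀ᶠ w in 𝓝 z, f w = c) : ∀ w ∈ unitDisc, f w = c :=
  hf.analyticOnNhd.eqOn_of_preconnected_of_eventuallyEq (analyticOnNhd_const (v := c))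
    isPreconnected_unitDisc hz h

/-- If `f` has no fixed point in the disc, then a non-constant left straightening separates every
point from its image under `f`. -/
theorem IsLeftStraightening.apply_ne {f h : ℂ → ℂ} (hf : IsHolSelfMap f)
    (hfix : ∀ z ∈ unitDisc, f z ≠ z) (hh : IsLeftStraightening f h) (hc : ¬ IsConstOnDisc h)
    {z₀ : ℂ} (hz₀ : z₀ ∈ unitDisc) : h (f z₀) ≠ h z₀ := by
  intro heq
  obtain ⟨γ, hγ, hlim⟩ := hh.exists_aut
  set F : ℕ → ℂ → ℂ := fun n => Function.invFunOn (γ n) unitDisc ∘ f^[n] with hFdef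
  have hF : ∀ n, IsHolSelfMap (F n) := fun n =>
    (hγ n).isHolSelfMap_invFunOn.comp (hf.iterate n)
  have hh1 := hh.isHolSelfMap
  have hne : ∀ᶠ z in 𝓝[≠] z₀, h z ≠ h z₀ := by
    refine ((hh1.analyticOnNhd z₀ hz₀).eventually_eq_or_eventually_ne
      analyticAt_const).resolve_left fun hev => hc ⟨h z₀, hh1.eqOn_const hz₀ hev⟩
  -- On this closed disc `h` takes the value `h z₀` only at its centre.
  obtain ⟨r, hr, hB⟩ := Metric.nhds_basis_closedBall.mem_iff.mp
    ((eventually_nhdsWithin_iff.mp hne).and (isOpen_unitDisc.mem_nhds hz₀))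
  have hBD : Metric.closedBall z₀ r ⊆ unitDisc := fun z hz => (hB hz).2
  have hSB : Metric.sphere z₀ r ⊆ Metric.closedBall z₀ r := Metric.sphere_subset_closedBall
  obtain ⟨x, hx⟩ : (Metric.sphere z₀ r).Nonempty := NormedSpace.sphere_nonempty.mpr hr.le
  obtain ⟨y, hy, hmin⟩ := (isCompact_sphere z₀ r).exists_isMinOn ⟨x, hx⟩
    (f := fun z => ‖h z - h z₀‖) (((hh1.differentiableOn.continuousOn.mono
      (hSB.trans hBD)).sub continuousOn_const).norm)
  set ε := ‖h y - h z₀‖ with hε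
  have hε0 : 0 < ε := norm_pos_iff.mpr (sub_ne_zero.mpr
    ((hB (hSB hy)).1 (Metric.ne_of_mem_sphere hy hr.ne')))
  have hunif := (tendstoLocallyUniformlyOn_iff_forall_isCompact isOpen_unitDisc).mp hlim _ hBD
    (isCompact_closedBall z₀ r)
  have hd := (((hlim.tendsto_at (hf.mapsTo hz₀)).sub (hlim.tendsto_at hz₀)).norm)
  rw [heq, sub_self, norm_zero] at hd
  obtain ⟨n, hn1, hn2⟩ := ((Metric.tendstoUniformlyOn_iff.mp hunif (ε / 4) (by positivity)).and
    (hd.eventually_lt_const (show 0 < ε / 4 by positivity))).exists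
  have hsph : ∀ z ∈ Metric.sphere z₀ r, ε / 2 ≤ ‖F n z - F n z₀‖ := fun z hz => by
    have h1 := hn1 z (hSB hz)
    have h2 := hn1 z₀ (Metric.mem_closedBall_self hr.le)
    have h3 : ε ≤ ‖h z - h z₀‖ := hmin hz
    rw [dist_eq_norm] at h1 h2
    have h4 : h z - h z₀ = (h z - F n z) + (F n z - F n z₀) - (h z₀ - F n z₀) := by ring
    rw [h4] at h3
    have h5 := norm_sub_le ((h z - F n z) + (F n z - F n z₀)) (h z₀ - F n z₀)
    have h6 := norm_add_le (h z - F n z) (F n z - F n z₀)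
    linarith
  have hfr : ∃ᶠ z in 𝓝 z₀, F n z ≠ F n z₀ := by
    intro hev
    have h1 := (hF n).eqOn_const hz₀ (hev.mono fun z hz => not_not.mp hz) x (hBD (hSB hx))
    have h2 := hsph x hx
    rw [h1, sub_self, norm_zero] at h2
    linarith
  have hdc : DiffContOnCl ℂ (F n) (Metric.ball z₀ r) :=
    ((hF n).differentiableOn.mono hBD).diffContOnCl_ball subset_rfl
  -- Quantitative open mapping: the bound `ε / 2` on the circle puts the ball of radius `ε / 4`
  -- about `F n z₀` inside the image of the closed disc, so the nearby value `F n (f z₀)` is taken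
  -- at some `b`. Invariance of `pdist` will force `b = z₀`, and then `f^[n] z₀` is fixed by `f`.
  obtain ⟨b, hb, hbeq⟩ := hdc.ball_subset_image_closedBall hr hsph hfr
    (show F n (f z₀) ∈ _ by rw [mem_ball_iff_norm]; exact hn2.trans_le (by linarith))
  have hbD := hBD hb
  have hfn : f^[n] b = f^[n] (f z₀) := by
    rw [← pdist_eq_zero ((hf.iterate n).mapsTo hbD) ((hf.iterate n).mapsTo (hf.mapsTo hz₀)),
      ← (hγ n).pdist_invFunOn ((hf.iterate n).mapsTo hbD) ((hf.iterate n).mapsTo (hf.mapsTo hz₀))]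
    exact (congrArg (pdist · (F n (f z₀))) hbeq).trans (pdist_self _)
  have hhb : h b = h (f z₀) := by
    rw [← pdist_eq_zero (hh1.mapsTo hbD) (hh1.mapsTo (hf.mapsTo hz₀)),
      ← hh.pdist_iterate hf hbD (hf.mapsTo hz₀) n, hfn, pdist_self]
  have hbz : b = z₀ := by
    by_contra hbz
    exact (hB hb).1 hbz (hhb.trans heq)
  refine hfix _ ((hf.iterate n).mapsTo hz₀) ?_
  rw [← Function.iterate_succ_apply' f, Function.iterate_succ_apply, ← hfn, hbz]

/-! ### Existence of a left straightening -/

/-- Write `G w = w * k w`. Then `k u = t`, and Schwarz–Pick for `k` keeps `k w` within a multiple of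
`1 - t ^ 2` of `t`, hence close to `1` when `t` is. -/
theorem IsHolSelfMap.norm_sub_self_le {G : ℂ → ℂ} (hG : IsHolSelfMap G) (h0 : G 0 = 0)
    {u w : ℂ} {t r : ℝ} (hu : u ∈ unitDisc) (hu0 : u ≠ 0) (ht : 0 ≤ t) (ht1 : t ≤ 1)
    (hGu : G u = t * u) (hw : w ∈ unitDisc) (hr : r < 1) (hwr : pdist w u ≤ r) :
    ‖G w - w‖ ≤ (r / (1 - r) * 2 + 1) * (1 - t) := by
  have hr0 : 0 ≤ r := (pdist_nonneg _ _).trans hwr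
  have hC : 0 ≤ r / (1 - r) := div_nonneg hr0 (by linarith)
  set k := dslope G 0 with hk
  have hm : Set.MapsTo G (Metric.ball 0 1) (Metric.closedBall (G 0) 1) := by
    rw [h0]; exact hG.mapsTo.mono_right Metric.ball_subset_closedBall
  have hk1 : ∀ z ∈ unitDisc, ‖k z‖ ≤ 1 := fun z hz => by
    simpa using Complex.norm_dslope_le_div_of_mapsTo_ball hG.differentiableOn hm hz
  have hkd : DifferentiableOn ℂ k unitDisc :=
    (Complex.differentiableOn_dslope (isOpen_unitDisc.mem_nhds zero_mem_unitDisc)).mpr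
      hG.differentiableOn
  have hGk : ∀ z, G z = z * k z := fun z => by
    have := sub_smul_dslope G 0 z
    rw [sub_zero, h0, sub_zero, smul_eq_mul] at this
    exact this.symm
  have hku : k u = t := by
    have := hGk u
    rw [hGu, mul_comm] at this
    exact (mul_left_cancel₀ hu0 this).symm
  -- `k` may take values on the unit circle, so Schwarz–Pick is applied to `s * k` with `s < 1`, and
  -- then `s → 1`.
  have hs : ∀ s : ℝ, 0 ≤ s → s < 1 → ‖s * k w - s * t‖ ≤ r / (1 - r) * (1 - (s * t) ^ 2) := by
    intro s hs0 hs1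
    have hsk : IsHolSelfMap (fun z => (s : ℂ) * k z) := by
      refine ⟨hkd.const_mul _, fun z hz => ?_⟩
      rw [mem_unitDisc, norm_mul, Complex.norm_real, Real.norm_of_nonneg hs0]
      nlinarith [hk1 z hz, norm_nonneg (k z)]
    have h1 := norm_sub_le_of_pdist_le (hsk.mapsTo hw) (hsk.mapsTo hu) hr
      ((hsk.pdist_le hw hu).trans hwr)
    rwa [hku, norm_mul, Complex.norm_real, Complex.norm_real, Real.norm_of_nonneg hs0,
      Real.norm_of_nonneg ht] at h1
  have hlim : ‖(1 : ℝ) * k w - (1 : ℝ) * t‖ ≤ r / (1 - r) * (1 - (1 * t) ^ 2) := by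
    have c1 : Continuous fun s : ℝ => ‖s * k w - s * t‖ := by fun_prop
    have c2 : Continuous fun s : ℝ => r / (1 - r) * (1 - (s * t) ^ 2) := by fun_prop
    refine le_of_tendsto_of_tendsto ((c1.tendsto 1).mono_left nhdsWithin_le_nhds)
      ((c2.tendsto 1).mono_left (nhdsWithin_le_nhds (s := Set.Iio 1))) ?_
    filter_upwards [Ioo_mem_nhdsLT zero_lt_one] with s hs'
    exact hs s hs'.1.le hs'.2
  rw [Complex.ofReal_one, one_mul, one_mul, one_mul] at hlim
  have e : G w - w = w * ((k w - t) - ((1 - t : ℝ) : ℂ)) := by rw [hGk]; push_cast; ring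
  have hfin : ‖(k w - t) - ((1 - t : ℝ) : ℂ)‖ ≤ (r / (1 - r) * 2 + 1) * (1 - t) := by
    refine (norm_sub_le _ _).trans ?_
    rw [Complex.norm_real, Real.norm_of_nonneg (by linarith)]
    have : 1 - t ^ 2 ≤ 2 * (1 - t) := by nlinarith
    nlinarith [mul_le_mul_of_nonneg_left this hC]
  rw [e, norm_mul]
  have := mem_unitDisc.mp hw
  nlinarith [norm_nonneg ((k w - t) - ((1 - t : ℝ) : ℂ)), norm_nonneg w]

/-- The automorphisms are `z ↦ discInv (f^[n] 0) (c n * z)`. As the normalised iterates fix `0`, the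
Schwarz lemma keeps the limit inside the open disc. -/
theorem isLeftStraightening_of_tendsto {f h : ℂ → ℂ} (hf : IsHolSelfMap f) {c : ℕ → ℂ}
    (hc : ∀ n, ‖c n‖ = 1)
    (hlim : ∀ z ∈ unitDisc, Tendsto (fun n => conj (c n) * discInv (f^[n] 0) (f^[n] z)) atTop
      (𝓝 (h z))) : IsLeftStraightening f h := by
  have ha : ∀ n, f^[n] 0 ∈ unitDisc := fun n => (hf.iterate n).mapsTo zero_mem_unitDisc
  set F : ℕ → ℂ → ℂ := fun n z => conj (c n) * discInv (f^[n] 0) (f^[n] z) with hFdef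
  have hF : ∀ n, IsHolSelfMap (F n) := fun n =>
    (isHolSelfMap_const_mul (c := conj (c n)) (by simp [hc])).comp
      ((isHolSelfMap_discInv (ha n)).comp (hf.iterate n))
  have hF0 : ∀ n, F n 0 = 0 := fun n => by simp [hFdef]
  have hunif := tendstoLocallyUniformlyOn_of_isHolSelfMap hF hlim
  refine ⟨⟨hunif.differentiableOn (Eventually.of_forall fun n => (hF n).differentiableOn)
    isOpen_unitDisc, fun z hz => ?_⟩, ?_, fun n z => discInv (f^[n] 0) (c n * z), fun n => ?_, ?_⟩
  · refine mem_unitDisc.mpr (lt_of_le_of_lt ?_ (mem_unitDisc.mp hz))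
    exact le_of_tendsto (hlim z hz).norm (Eventually.of_forall fun n => (hF n).norm_le (hF0 n) hz)
  · refine tendsto_nhds_unique (hlim 0 zero_mem_unitDisc) ?_
    exact (tendsto_congr hF0).mpr tendsto_const_nhds
  · exact (isDiscAut_discInv (ha n)).comp (isDiscAut_const_mul (hc n))
  · refine hunif.congr fun n z hz => ?_
    have hγ : IsDiscAut fun z => discInv (f^[n] 0) (c n * z) :=
      (isDiscAut_discInv (ha n)).comp (isDiscAut_const_mul (hc n))
    have h1 := hγ.invFunOn_apply ((hF n).mapsTo hz)
    have h2 : c n * F n z = discInv (f^[n] 0) (f^[n] z) := by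
      rw [hFdef]
      linear_combination discInv (f^[n] 0) (f^[n] z) * conj_mul_self_of_norm_one (hc n)
    have h3 : discInv (f^[n] 0) (c n * F n z) = f^[n] z := by
      rw [h2, discInv_discInv (ha n) ((hf.iterate n).mapsTo hz)]
    simp only [h3] at h1
    exact h1.symm

theorem exists_isLeftStraightening {f : ℂ → ℂ} (hf : IsHolSelfMap f) :
    ∃ h, IsLeftStraightening f h := by
  have ha : ∀ n, f^[n] 0 ∈ unitDisc := fun n => (hf.iterate n).mapsTo zero_mem_unitDisc
  by_cases hall : ∀ z ∈ unitDisc, Tendsto (fun n => pdist (f^[n] z) (f^[n] 0)) atTop (𝓝 0)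
  · refine ⟨fun _ => 0, isLeftStraightening_of_tendsto hf (c := fun _ => 1) (by simp)
      fun z hz => ?_⟩
    rw [tendsto_zero_iff_norm_tendsto_zero]
    simpa [norm_discInv] using hall z hz
  · push Not at hall
    obtain ⟨z₀, hz₀, hnot⟩ := hall
    obtain ⟨s, hs, hsle⟩ := hf.tendsto_pdist_iterate hz₀ zero_mem_unitDisc
    have hanti := hf.antitone_pdist_iterate hz₀ zero_mem_unitDisc
    have hs0 : 0 < s := by
      refine lt_of_le_of_ne (ge_of_tendsto' hs fun n => pdist_nonneg _ _) ?_
      rintro rfl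
      exact hnot hs
    set u : ℕ → ℝ := fun n => pdist (f^[n] z₀) (f^[n] 0) with hu
    have hupos : ∀ n, 0 < u n := fun n => hs0.trans_le (hsle n)
    set k : ℕ → ℂ → ℂ := fun n z => discInv (f^[n] 0) (f^[n] z) with hk
    have hknorm : ∀ n, ‖k n z₀‖ = u n := fun n => norm_discInv _ _
    have huC : ∀ n, (u n : ℂ) ≠ 0 := fun n => Complex.ofReal_ne_zero.mpr (hupos n).ne'
    set c : ℕ → ℂ := fun n => k n z₀ / u n with hcdef
    have hc : ∀ n, ‖c n‖ = 1 := fun n => by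
      rw [hcdef, norm_div, hknorm, Complex.norm_real, Real.norm_of_nonneg (hupos n).le,
        div_self (hupos n).ne']
    have hck : ∀ n, c n * u n = k n z₀ := fun n => div_mul_cancel₀ _ (huC n)
    set H : ℕ → ℂ → ℂ := fun n z => conj (c n) * k n z with hH
    have hHs : ∀ n, IsHolSelfMap (H n) := fun n =>
      (isHolSelfMap_const_mul (c := conj (c n)) (by simp [hc])).comp
        ((isHolSelfMap_discInv (ha n)).comp (hf.iterate n))
    have hH0 : ∀ n, H n z₀ = u n := fun n => by
      change conj (c n) * k n z₀ = u n
      rw [← hck]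
      linear_combination (u n : ℂ) * conj_mul_self_of_norm_one (hc n)
    have hcH : ∀ n z, c n * H n z = k n z := fun n z => by
      rw [hH]
      linear_combination k n z * conj_mul_self_of_norm_one (hc n)
    -- The transition map `G` satisfies `H m = G ∘ H n` on the disc, `G 0 = 0` and `G (u n) = u m`,
    -- so the near-identity estimate applies with `t = u m / u n`.
    have hest : ∀ n m, n ≤ m → ∀ z ∈ unitDisc, ‖H m z - H n z‖ ≤
        (pdist z z₀ / (1 - pdist z z₀) * 2 + 1) * (1 - u m / u n) := by
      intro n m hnm z hz
      set G : ℂ → ℂ := fun w =>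
        conj (c m) * discInv (f^[m] 0) (f^[m - n] (discInv (f^[n] 0) (c n * w))) with hG
      have hGs : IsHolSelfMap G :=
        (isHolSelfMap_const_mul (c := conj (c m)) (by simp [hc])).comp
          ((isHolSelfMap_discInv (ha m)).comp ((hf.iterate (m - n)).comp
            ((isHolSelfMap_discInv (ha n)).comp (isHolSelfMap_const_mul (hc n).le))))
      have hit : ∀ z, f^[m - n] (f^[n] z) = f^[m] z := fun z => by
        rw [← Function.iterate_add_apply, Nat.sub_add_cancel hnm]
      have hG0 : G 0 = 0 := by simp [hG, hit]
      have hGH : ∀ z ∈ unitDisc, G (H n z) = H m z := fun z hz => by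
        simp only [hG, hcH]
        rw [hk, discInv_discInv (ha n) ((hf.iterate n).mapsTo hz), hit]
      have hun : (u n : ℂ) ∈ unitDisc := by rw [← hH0]; exact (hHs n).mapsTo hz₀
      rw [← hGH z hz]
      refine hGs.norm_sub_self_le hG0 hun (huC n) (div_nonneg (hupos m).le (hupos n).le)
        ((div_le_one (hupos n)).mpr (hanti hnm)) ?_ ((hHs n).mapsTo hz) (pdist_lt_one hz hz₀) ?_
      · rw [← hH0 n, hGH z₀ hz₀, hH0, hH0, Complex.ofReal_div, div_mul_cancel₀ _ (huC n)]
      · rw [← hH0 n]; exact (hHs n).pdist_le hz hz₀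
    have hcauchy : ∀ z ∈ unitDisc, ∃ l, Tendsto (fun n => H n z) atTop (𝓝 l) := by
      intro z hz
      refine cauchySeq_tendsto_of_complete (Metric.cauchySeq_iff'.mpr fun ε hε => ?_)
      set C := pdist z z₀ / (1 - pdist z z₀) * 2 + 1 with hC
      have hCpos : 0 < C := by
        have := pdist_lt_one hz hz₀
        have : 0 ≤ pdist z z₀ / (1 - pdist z z₀) := div_nonneg (pdist_nonneg _ _) (by linarith)
        positivity
      have h1 : Tendsto (fun n => C * (1 - s / u n)) atTop (𝓝 0) := by
        have := (tendsto_const_nhds (x := C)).mul ((tendsto_const_nhds (x := (1 : ℝ))).sub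
          ((tendsto_const_nhds (x := s)).div hs hs0.ne'))
        simpa [div_self hs0.ne'] using this
      obtain ⟨N, hN⟩ := (h1.eventually_lt_const hε).exists
      refine ⟨N, fun n hn => ?_⟩
      rw [dist_eq_norm]
      refine (hest N n hn z hz).trans_lt (lt_of_le_of_lt ?_ hN)
      have : s / u N ≤ u n / u N := div_le_div_of_nonneg_right (hsle n) (hupos N).le
      exact mul_le_mul_of_nonneg_left (by linarith) hCpos.le
    choose! h hh using hcauchy
    exact ⟨h, isLeftStraightening_of_tendsto hf hc hh⟩

/-! ### Automorphisms and maps with a fixed point -/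

theorem IsLeftStraightening.isDiscAut_iff {f h : ℂ → ℂ} (hf : IsHolSelfMap f)
    (hh : IsLeftStraightening f h) : IsDiscAut f ↔ IsDiscAut h := by
  have h1 : (1 / 2 : ℂ) ∈ unitDisc := by rw [mem_unitDisc]; norm_num
  have h2 : (1 / 2 : ℂ) ≠ 0 := by norm_num
  constructor
  · intro hfa
    refine hh.isHolSelfMap.isDiscAut_of_pdist_eq h1 zero_mem_unitDisc h2 ?_
    refine tendsto_nhds_unique (hh.tendsto_pdist hf h1 zero_mem_unitDisc) ?_
    have : ∀ n, pdist (f^[n] (1 / 2)) (f^[n] 0) = pdist (1 / 2) 0 := fun n => by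
      induction n with
      | zero => rfl
      | succ n ih =>
        rw [Function.iterate_succ_apply', Function.iterate_succ_apply', ← ih]
        exact hfa.pdist_eq ((hf.iterate n).mapsTo h1) ((hf.iterate n).mapsTo zero_mem_unitDisc)
    exact (tendsto_congr this).mpr tendsto_const_nhds
  · intro hha
    refine hf.isDiscAut_of_pdist_eq h1 zero_mem_unitDisc h2
      (le_antisymm (hf.pdist_le h1 zero_mem_unitDisc) ?_)
    rw [← hha.pdist_eq h1 zero_mem_unitDisc]
    -- A decreasing sequence dominates its limit; the term of index `1` is the distance between the
    -- images under `f` itself.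
    exact (hf.antitone_pdist_iterate h1 zero_mem_unitDisc).le_of_tendsto
      (hh.tendsto_pdist hf h1 zero_mem_unitDisc) 1

theorem IsHolSelfMap.continuousAt {f : ℂ → ℂ} (hf : IsHolSelfMap f) {z : ℂ}
    (hz : z ∈ unitDisc) : ContinuousAt f z :=
  (hf.differentiableOn.differentiableAt (isOpen_unitDisc.mem_nhds hz)).continuousAt

/-- Both `pdist a b` and `pdist (f a) (f b)` equal the limiting distance of the two orbits, so `a ≠
b` would be an equality case of Schwarz–Pick. -/
theorem IsHolSelfMap.eq_of_tendsto_iterate {f : ℂ → ℂ} (hf : IsHolSelfMap f)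
    (hna : ¬ IsDiscAut f) {z w a b : ℂ} (hz : z ∈ unitDisc) (hw : w ∈ unitDisc)
    (ha : a ∈ unitDisc) (hb : b ∈ unitDisc) {φ : ℕ → ℕ} (hφ : Tendsto φ atTop atTop)
    (hza : Tendsto (fun k => f^[φ k] z) atTop (𝓝 a))
    (hwb : Tendsto (fun k => f^[φ k] w) atTop (𝓝 b)) : a = b := by
  obtain ⟨s, hs, -⟩ := hf.tendsto_pdist_iterate hz hw
  have h1 : pdist a b = s := tendsto_nhds_unique (tendsto_pdist hza hwb ha hb) (hs.comp hφ)
  have h2 : pdist (f a) (f b) = s := by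
    refine tendsto_nhds_unique (tendsto_pdist ((hf.continuousAt ha).tendsto.comp hza)
      ((hf.continuousAt hb).tendsto.comp hwb) (hf.mapsTo ha) (hf.mapsTo hb)) ?_
    have := ((tendsto_add_atTop_iff_nat 1).mpr hs).comp hφ
    simpa only [Function.comp_def, Function.iterate_succ_apply'] using this
  by_contra hab
  exact hna (hf.isDiscAut_of_pdist_eq ha hb hab (h2.trans h1.symm))

/-- The orbit of `z` stays in a compact pseudo-hyperbolic disc about `p`, so it has a limit point in
the disc, which must be `p`. The limiting distance to `p` is therefore `0`. -/
theorem IsLeftStraightening.isConstOnDisc_of_fixed {f h : ℂ → ℂ} (hf : IsHolSelfMap f)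
    (hna : ¬ IsDiscAut f) (hh : IsLeftStraightening f h) {p : ℂ} (hp : p ∈ unitDisc)
    (hfp : f p = p) : IsConstOnDisc h := by
  refine ⟨h p, fun z hz => ?_⟩
  have hpn : ∀ n, f^[n] p = p := fun n => Function.iterate_fixed hfp n
  have hlim := hh.tendsto_pdist hf hz hp
  simp only [hpn] at hlim
  rw [← pdist_eq_zero (hh.isHolSelfMap.mapsTo hz) (hh.isHolSelfMap.mapsTo hp)]
  have hmem : ∀ n, discInv p (f^[n] z) ∈ Metric.closedBall (0 : ℂ) (pdist z p) := fun n => by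
    rw [mem_closedBall_zero_iff, norm_discInv]
    have := hf.antitone_pdist_iterate hz hp (Nat.zero_le n)
    simpa [hpn] using this
  obtain ⟨a, ha, φ, hφ, hφa⟩ := (isCompact_closedBall (0 : ℂ) (pdist z p)).tendsto_subseq hmem
  have haD : a ∈ unitDisc :=
    mem_unitDisc.mpr ((mem_closedBall_zero_iff.mp ha).trans_lt (pdist_lt_one hz hp))
  have hza : Tendsto (fun k => f^[φ k] z) atTop (𝓝 (discInv p a)) := by
    refine (((isHolSelfMap_discInv hp).continuousAt haD).tendsto.comp hφa).congr fun k => ?_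
    exact discInv_discInv hp ((hf.iterate _).mapsTo hz)
  have hap := hf.eq_of_tendsto_iterate hna hz hp (mapsTo_discInv hp haD) hp hφ.tendsto_atTop hza
    (by simp [hpn])
  refine tendsto_nhds_unique (hlim.comp hφ.tendsto_atTop) ?_
  have := _root_.tendsto_pdist hza (tendsto_const_nhds (x := p)) (mapsTo_discInv hp haD) hp
  rwa [hap, pdist_self] at this

/-! ### Horocycles, Wolff's lemma and the Denjoy–Wolff theorem -/

/-- The level sets of `horo τ` are the horocycles of the disc with vertex `τ`. -/
noncomputable def horo (τ z : ℂ) : ℝ := ‖τ - z‖ ^ 2 / (1 - ‖z‖ ^ 2)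

/-- Minimise the displacement `pdist z (g z)` over the closed disc of radius `r`, which `g = r * f`
maps into itself. At a point that is not fixed, applying `g` strictly decreases the displacement,
since `g` is not surjective. -/
theorem IsHolSelfMap.exists_mul_fixed {f : ℂ → ℂ} (hf : IsHolSelfMap f) {r : ℝ} (hr : 0 ≤ r)
    (hr1 : r < 1) : ∃ z ∈ unitDisc, r * f z = z := by
  set g : ℂ → ℂ := fun z => r * f z with hg
  have hgn : ∀ z ∈ unitDisc, ‖g z‖ ≤ r := fun z hz => by
    rw [hg, norm_mul, Complex.norm_real, Real.norm_of_nonneg hr]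
    have := mem_unitDisc.mp (hf.mapsTo hz)
    nlinarith
  have hgs : IsHolSelfMap g := (isHolSelfMap_const_mul (c := (r : ℂ))
    (by rw [Complex.norm_real, Real.norm_of_nonneg hr]; exact hr1.le)).comp hf
  have hgna : ¬ IsDiscAut g := fun hga => by
    obtain ⟨z, hz, hzg⟩ := hga.bijOn.surjOn (show (((1 + r) / 2 : ℝ) : ℂ) ∈ unitDisc by
      rw [mem_unitDisc, Complex.norm_real, Real.norm_of_nonneg (by linarith)]; linarith)
    have := hgn z hz
    rw [hzg, Complex.norm_real, Real.norm_of_nonneg (by linarith)] at this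
    linarith
  have hsub : Metric.closedBall (0 : ℂ) r ⊆ unitDisc := Metric.closedBall_subset_ball hr1
  obtain ⟨z, hz, hmin⟩ := (isCompact_closedBall (0 : ℂ) r).exists_isMinOn
    ⟨0, Metric.mem_closedBall_self hr⟩ (f := fun z => pdist z (g z)) fun z hz =>
      tendsto_pdist (tendsto_id.mono_left nhdsWithin_le_nhds)
        ((hgs.continuousAt (hsub hz)).tendsto.mono_left nhdsWithin_le_nhds) (hsub hz)
        (hgs.mapsTo (hsub hz))
  refine ⟨z, hsub hz, ?_⟩
  by_contra hne
  have hz1 := hsub hz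
  have h1 : pdist z (g z) ≤ pdist (g z) (g (g z)) :=
    hmin (mem_closedBall_zero_iff.mpr (hgn z hz1))
  exact hgna (hgs.isDiscAut_of_pdist_eq hz1 (hgs.mapsTo hz1) (Ne.symm hne)
    (le_antisymm (hgs.pdist_le hz1 (hgs.mapsTo hz1)) h1))

theorem norm_one_sub_conj_mul_of_norm_one {τ : ℂ} (hτ : ‖τ‖ = 1) (z : ℂ) :
    ‖1 - conj τ * z‖ = ‖τ - z‖ := by
  have h := sq_norm_one_sub_conj_mul τ z
  rw [hτ] at h
  exact (sq_eq_sq₀ (norm_nonneg _) (norm_nonneg _)).mp (by linarith)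

/-- Wolff's lemma. -/
theorem IsHolSelfMap.exists_horo_le {f : ℂ → ℂ} (hf : IsHolSelfMap f)
    (hfix : ∀ z ∈ unitDisc, f z ≠ z) :
    ∃ τ : ℂ, ‖τ‖ = 1 ∧ ∀ z ∈ unitDisc, horo τ (f z) ≤ horo τ z := by
  set r : ℕ → ℝ := fun n => 1 - 1 / ((n : ℝ) + 1) with hr
  have hrlim : Tendsto r atTop (𝓝 1) := by
    have := (tendsto_const_nhds (x := (1 : ℝ))).sub
      (tendsto_one_div_add_atTop_nhds_zero_nat (𝕜 := ℝ))
    rw [sub_zero] at this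
    exact this
  have hr0 : ∀ n, 0 ≤ r n := fun n => by
    rw [hr, sub_nonneg, div_le_one (by positivity)]
    linarith [Nat.cast_nonneg (α := ℝ) n]
  have hr1 : ∀ n, r n < 1 := fun n => by
    have : 0 < 1 / ((n : ℝ) + 1) := by positivity
    rw [hr]; linarith
  choose p hp hfp using fun n => hf.exists_mul_fixed (hr0 n) (hr1 n)
  obtain ⟨τ, hτ, φ, hφ, hφτ⟩ := (isCompact_closedBall (0 : ℂ) 1).tendsto_subseq
    fun n => Metric.ball_subset_closedBall (hp n)
  have hrφ : Tendsto (fun k => (r (φ k) : ℂ)) atTop (𝓝 1) := by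
    have := (Complex.continuous_ofReal.tendsto 1).comp (hrlim.comp hφ.tendsto_atTop)
    rw [Complex.ofReal_one] at this
    exact this
  have hτ1 : ‖τ‖ = 1 := by
    refine le_antisymm (mem_closedBall_zero_iff.mp hτ) (not_lt.mp fun hlt => ?_)
    have hτD := mem_unitDisc.mpr hlt
    have h1 := hrφ.mul ((hf.continuousAt hτD).tendsto.comp hφτ)
    rw [one_mul] at h1
    exact hfix τ hτD (tendsto_nhds_unique (h1.congr fun k => hfp (φ k)) hφτ)
  refine ⟨τ, hτ1, fun z hz => ?_⟩
  have hle : ∀ k, (1 - ‖z‖ ^ 2) * ‖1 - conj (p (φ k)) * (r (φ k) * f z)‖ ^ 2 ≤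
      (1 - ‖r (φ k) * f z‖ ^ 2) * ‖1 - conj (p (φ k)) * z‖ ^ 2 := fun k => by
    set n := φ k
    have hgs : IsHolSelfMap (fun z => (r n : ℂ) * f z) := (isHolSelfMap_const_mul (c := (r n : ℂ))
      (by rw [Complex.norm_real, Real.norm_of_nonneg (hr0 n)]; exact (hr1 n).le)).comp hf
    have h1 := hgs.pdist_le hz (hp n)
    rw [hfp] at h1
    have h2 := one_sub_sq_pdist hz (hp n)
    have h3 := one_sub_sq_pdist (hgs.mapsTo hz) (hp n)
    have h4 : 1 - pdist z (p n) ^ 2 ≤ 1 - pdist (r n * f z) (p n) ^ 2 := by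
      have := pow_le_pow_left₀ (pdist_nonneg _ _) h1 2
      linarith
    rw [h2, h3, div_le_div_iff₀ (by have := norm_one_sub_conj_mul_pos hz (hp n); positivity)
      (by have := norm_one_sub_conj_mul_pos (hgs.mapsTo hz) (hp n); positivity)] at h4
    -- The factor `1 - ‖p n‖ ^ 2`, which degenerates in the limit, cancels beforehand.
    have h5 := one_sub_sq_norm_pos (hp n)
    exact le_of_mul_le_mul_left (by linarith) h5
  have hpc : Tendsto (fun k => conj (p (φ k))) atTop (𝓝 (conj τ)) :=
    (Complex.continuous_conj.tendsto τ).comp hφτ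
  have hrf : Tendsto (fun k => (r (φ k) : ℂ) * f z) atTop (𝓝 (f z)) := by
    simpa using hrφ.mul_const (f z)
  have hlim : (1 - ‖z‖ ^ 2) * ‖1 - conj τ * f z‖ ^ 2 ≤ (1 - ‖f z‖ ^ 2) * ‖1 - conj τ * z‖ ^ 2 :=
    le_of_tendsto_of_tendsto'
      (((tendsto_const_nhds.sub (hpc.mul hrf)).norm.pow 2).const_mul _)
      ((tendsto_const_nhds.sub (hrf.norm.pow 2)).mul
        ((tendsto_const_nhds.sub (hpc.mul_const z)).norm.pow 2)) hle
  rw [norm_one_sub_conj_mul_of_norm_one hτ1, norm_one_sub_conj_mul_of_norm_one hτ1] at hlim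
  rw [horo, horo, div_le_div_iff₀ (one_sub_sq_norm_pos (hf.mapsTo hz)) (one_sub_sq_norm_pos hz)]
  linarith

theorem norm_sub_sq_eq_horo_mul {z : ℂ} (τ : ℂ) (hz : z ∈ unitDisc) :
    ‖τ - z‖ ^ 2 = horo τ z * (1 - ‖z‖ ^ 2) :=
  (div_mul_cancel₀ _ (one_sub_sq_norm_pos hz).ne').symm

/-- The Denjoy–Wolff theorem, together with the invariance of the horocycles at the Wolff point. -/
theorem IsHolSelfMap.exists_isWolffPoint {f : ℂ → ℂ} (hf : IsHolSelfMap f)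
    (hna : ¬ IsDiscAut f) (hfix : ∀ z ∈ unitDisc, f z ≠ z) :
    ∃ τ : ℂ, IsWolffPoint f τ ∧ ∀ z ∈ unitDisc, horo τ (f z) ≤ horo τ z := by
  obtain ⟨τ, hτ, hle⟩ := hf.exists_horo_le hfix
  refine ⟨τ, ⟨hτ, tendstoLocallyUniformlyOn_of_isHolSelfMap hf.iterate fun z hz => ?_⟩, hle⟩
  have hn : ∀ n, f^[n] z ∈ unitDisc := fun n => (hf.iterate n).mapsTo hz
  have hhoro : ∀ n, horo τ (f^[n] z) ≤ horo τ z := fun n => by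
    induction n with
    | zero => rfl
    | succ n ih => rw [Function.iterate_succ_apply']; exact (hle _ (hn n)).trans ih
  refine tendsto_of_subseq_tendsto fun ns hns => ?_
  obtain ⟨a, ha, φ, hφ, hφa⟩ := (isCompact_closedBall (0 : ℂ) 1).tendsto_subseq
    fun n => Metric.ball_subset_closedBall (hn (ns n))
  refine ⟨φ, ?_⟩
  have ha1 : ‖a‖ = 1 := by
    refine le_antisymm (mem_closedBall_zero_iff.mp ha) (not_lt.mp fun hlt => ?_)
    have haD := mem_unitDisc.mpr hlt
    -- Along the same indices the orbits of `z` and `f z` tend to `a` and `f a`; an interior `a`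
    -- would thus be fixed.
    refine hfix a haD (hf.eq_of_tendsto_iterate hna hz (hf.mapsTo hz) haD (hf.mapsTo haD)
      (hns.comp hφ.tendsto_atTop) hφa ?_).symm
    refine ((hf.continuousAt haD).tendsto.comp hφa).congr fun k => ?_
    simp only [Function.comp_apply]
    rw [← Function.iterate_succ_apply' f, Function.iterate_succ_apply]
  have h1 : ‖τ - a‖ ^ 2 ≤ horo τ z * (1 - ‖a‖ ^ 2) := by
    refine le_of_tendsto_of_tendsto' ((tendsto_const_nhds.sub hφa).norm.pow 2)
      ((tendsto_const_nhds.sub (hφa.norm.pow 2)).const_mul (horo τ z)) fun k => ?_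
    have hk := hn (ns (φ k))
    simp only [Function.comp_apply]
    rw [norm_sub_sq_eq_horo_mul τ hk]
    exact mul_le_mul_of_nonneg_right (hhoro _) (one_sub_sq_norm_pos hk).le
  rw [ha1] at h1
  have h2 : ‖τ - a‖ = 0 := by nlinarith [norm_nonneg (τ - a)]
  rw [sub_eq_zero.mp (norm_eq_zero.mp h2)]
  exact hφa

/-! ### Half-plane maps and the Cayley transform -/

/-- The Schwarz–Pick lemma for maps from the disc to the right half-plane. -/
theorem norm_sub_im_mul_le_of_re_pos {G : ℂ → ℂ} (hG : DifferentiableOn ℂ G unitDisc)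
    (hre : ∀ z ∈ unitDisc, 0 < (G z).re) {z z₀ : ℂ} (hz : z ∈ unitDisc) (hz₀ : z₀ ∈ unitDisc) :
    ‖G z - (G z₀).im * Complex.I‖ * (1 - pdist z z₀) ≤ (G z₀).re * (1 + pdist z z₀) := by
  set A := G z₀ with hA
  have hApos : 0 < A.re := hre z₀ hz₀
  have hne : ∀ w ∈ unitDisc, G w + conj A ≠ 0 := fun w hw h0 => by
    have := congrArg Complex.re h0
    simp only [Complex.add_re, Complex.conj_re, Complex.zero_re] at this
    linarith [hre w hw]
  set K : ℂ → ℂ := fun w => (G w - A) / (G w + conj A) with hK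
  have hKs : IsHolSelfMap K := by
    refine ⟨(hG.sub_const A).div (hG.add_const (conj A)) hne, fun w hw => ?_⟩
    rw [mem_unitDisc, hK, norm_div, div_lt_one (norm_pos_iff.mpr (hne w hw)),
      ← sq_lt_sq₀ (norm_nonneg _) (norm_nonneg _), ← Complex.normSq_eq_norm_sq,
      ← Complex.normSq_eq_norm_sq, Complex.normSq_apply, Complex.normSq_apply]
    simp only [Complex.add_re, Complex.sub_re, Complex.add_im, Complex.sub_im, Complex.conj_re,
      Complex.conj_im]
    nlinarith [mul_pos (hre w hw) hApos]
  have h1 : ‖K z‖ ≤ pdist z z₀ := by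
    have h2 := (hKs.comp (isHolSelfMap_discInv hz₀)).norm_le (by simp [hK, hA])
      (mapsTo_discInv hz₀ hz)
    simpa [discInv_discInv hz₀ hz, norm_discInv] using h2
  rw [hK, norm_div, div_le_iff₀ (norm_pos_iff.mpr (hne z hz))] at h1
  set X := G z - A.im * Complex.I with hX
  have e1 : G z - A = X - A.re := by
    rw [hX]; nth_rewrite 1 [← Complex.re_add_im A]; ring
  have e2 : G z + conj A = X + A.re := by
    apply Complex.ext <;> simp [hX]
    ring
  rw [e1, e2] at h1
  have hAn : ‖(A.re : ℂ)‖ = A.re := by rw [Complex.norm_real, Real.norm_of_nonneg hApos.le]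
  have h3 := norm_sub_norm_le X (A.re : ℂ)
  have h4 := norm_add_le X (A.re : ℂ)
  rw [hAn] at h3 h4
  have h5 := mul_le_mul_of_nonneg_left h4 (pdist_nonneg z z₀)
  linarith

theorem norm_sub_im_mul_le_of_re_nonneg {G : ℂ → ℂ} (hG : DifferentiableOn ℂ G unitDisc)
    (hre : ∀ z ∈ unitDisc, 0 ≤ (G z).re) {z z₀ : ℂ} (hz : z ∈ unitDisc) (hz₀ : z₀ ∈ unitDisc) :
    ‖G z - (G z₀).im * Complex.I‖ * (1 - pdist z z₀) ≤ (G z₀).re * (1 + pdist z z₀) := by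
  have h1 : ∀ δ : ℝ, 0 < δ → ‖(G z + δ) - (G z₀).im * Complex.I‖ * (1 - pdist z z₀) ≤
      ((G z₀).re + δ) * (1 + pdist z z₀) := fun δ hδ => by
    have := norm_sub_im_mul_le_of_re_pos (hG.add_const (δ : ℂ))
      (fun w hw => by simpa using add_pos_of_nonneg_of_pos (hre w hw) hδ) hz hz₀
    simpa using this
  have c1 : Continuous fun δ : ℝ =>
    ‖(G z + δ) - (G z₀).im * Complex.I‖ * (1 - pdist z z₀) := by fun_prop
  have c2 : Continuous fun δ : ℝ => ((G z₀).re + δ) * (1 + pdist z z₀) := by fun_prop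
  have := le_of_tendsto_of_tendsto ((c1.tendsto 0).mono_left nhdsWithin_le_nhds)
    ((c2.tendsto 0).mono_left (nhdsWithin_le_nhds (s := Set.Ioi 0)))
    (eventually_nhdsWithin_of_forall h1)
  simpa using this

/-- The Cayley transform of the disc onto the right half-plane that sends `τ` to infinity. -/
noncomputable def cayley (τ z : ℂ) : ℂ := (τ + z) / (τ - z)

theorem sub_ne_zero_of_mem_unitDisc {τ z : ℂ} (hτ : ‖τ‖ = 1) (hz : z ∈ unitDisc) : τ - z ≠ 0 := by
  intro h
  have := mem_unitDisc.mp hz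
  rw [← sub_eq_zero.mp h, hτ] at this
  exact lt_irrefl _ this

theorem add_ne_zero_of_mem_unitDisc {τ z : ℂ} (hτ : ‖τ‖ = 1) (hz : z ∈ unitDisc) : τ + z ≠ 0 := by
  rw [← sub_neg_eq_add]
  exact sub_ne_zero_of_mem_unitDisc hτ (by rwa [mem_unitDisc, norm_neg, ← mem_unitDisc])

/-- Turns inequalities between horocycles into inequalities between real parts of half-plane maps.
-/
theorem cayley_re {τ : ℂ} (hτ : ‖τ‖ = 1) (z : ℂ) : (cayley τ z).re = (horo τ z)⁻¹ := by
  have h : τ.re * τ.re + τ.im * τ.im = 1 := by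
    rw [← Complex.normSq_apply, Complex.normSq_eq_norm_sq, hτ, one_pow]
  rw [cayley, horo, inv_div, Complex.div_re, ← add_div, Complex.normSq_eq_norm_sq,
    ← Complex.normSq_eq_norm_sq z, Complex.normSq_apply]
  congr 1
  simp only [Complex.add_re, Complex.sub_re, Complex.add_im, Complex.sub_im]
  linarith

theorem horo_pos {τ z : ℂ} (hτ : ‖τ‖ = 1) (hz : z ∈ unitDisc) : 0 < horo τ z := by
  have := norm_pos_iff.mpr (sub_ne_zero_of_mem_unitDisc hτ hz)
  have := one_sub_sq_norm_pos hz
  unfold horo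
  positivity

theorem differentiableOn_cayley {τ : ℂ} (hτ : ‖τ‖ = 1) :
    DifferentiableOn ℂ (cayley τ) unitDisc := by
  unfold cayley
  exact DifferentiableOn.div (by fun_prop) (by fun_prop) fun z hz =>
    sub_ne_zero_of_mem_unitDisc hτ hz

/-- Harnack's inequality for the Poisson kernel. -/
theorem sub_one_le_pdist_mul_of_mul_horo_le {τ z w : ℂ} {c : ℝ} (hτ : ‖τ‖ = 1)
    (hz : z ∈ unitDisc) (hw : w ∈ unitDisc) (h : c * horo τ w ≤ horo τ z) :
    c - 1 ≤ pdist z w * (c + 1) := by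
  have hz' := horo_pos hτ hz
  have hw' := horo_pos hτ hw
  have h1 := norm_sub_im_mul_le_of_re_pos (differentiableOn_cayley hτ)
    (fun u hu => by rw [cayley_re hτ]; exact inv_pos.mpr (horo_pos hτ hu)) hw hz
  have h2 := Complex.re_le_norm (cayley τ w - (cayley τ z).im * Complex.I)
  simp only [Complex.sub_re, Complex.mul_re, Complex.ofReal_re, Complex.I_re, Complex.ofReal_im,
    Complex.I_im, mul_zero, zero_mul, sub_zero] at h2
  rw [cayley_re hτ] at h1 h2
  rw [pdist_comm z w]
  have h3 : 0 < 1 - pdist w z := by linarith [pdist_lt_one hw hz]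
  have h4 : (horo τ w)⁻¹ * (1 - pdist w z) ≤ (horo τ z)⁻¹ * (1 + pdist w z) :=
    (mul_le_mul_of_nonneg_right h2 h3.le).trans h1
  have h5 : c * (horo τ z)⁻¹ ≤ (horo τ w)⁻¹ := by
    rw [← div_eq_mul_inv, div_le_iff₀ hz', ← div_eq_inv_mul, le_div_iff₀ hw']
    exact h
  have h6 : (horo τ z)⁻¹ * (c * (1 - pdist w z)) ≤ (horo τ z)⁻¹ * (1 + pdist w z) := by
    refine le_trans ?_ h4
    rw [← mul_assoc, mul_comm _ c]
    exact mul_le_mul_of_nonneg_right h5 h3.le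
  have h7 := le_of_mul_le_mul_left h6 (inv_pos.mpr hz')
  linarith

/-! ### Angular limits and the Julia–Wolff–Carathéodory theorem -/

theorem HasAngularLimit.congr {F G : ℂ → ℂ} {τ l : ℂ} (h : HasAngularLimit F τ l)
    (hFG : Set.EqOn G F unitDisc) : HasAngularLimit G τ l := fun M hM =>
  (h M hM).congr' (eventually_nhdsWithin_of_forall fun _ hz => (hFG hz.1).symm)

theorem neBot_nhdsWithin_stolzRegion {τ : ℂ} (hτ : ‖τ‖ = 1) {M : ℝ} (hM : 1 < M) :
    (𝓝[stolzRegion τ M] τ).NeBot := by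
  have h1 : Tendsto (fun r : ℝ => (r : ℂ) * τ) (𝓝[<] 1) (𝓝[stolzRegion τ M] τ) := by
    refine tendsto_nhdsWithin_iff.mpr ⟨?_, ?_⟩
    · have c : Continuous fun r : ℝ => (r : ℂ) * τ := by fun_prop
      have := (c.tendsto 1).mono_left (nhdsWithin_le_nhds (s := Set.Iio 1))
      simpa using this
    · filter_upwards [Ioo_mem_nhdsLT zero_lt_one] with r hr
      have hn : ‖(r : ℂ) * τ‖ = r := by
        rw [norm_mul, hτ, mul_one, Complex.norm_real, Real.norm_of_nonneg hr.1.le]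
      refine ⟨by rw [mem_unitDisc, hn]; exact hr.2, ?_⟩
      have e : τ - r * τ = ((1 - r : ℝ) : ℂ) * τ := by push_cast; ring
      rw [hn, e, norm_mul, hτ, mul_one, Complex.norm_real, Real.norm_of_nonneg (by linarith [hr.2])]
      nlinarith [hr.2]
  exact h1.neBot

theorem HasAngularLimit.unique {F : ℂ → ℂ} {τ l l' : ℂ} (hτ : ‖τ‖ = 1)
    (h : HasAngularLimit F τ l) (h' : HasAngularLimit F τ l') : l = l' := by
  have := neBot_nhdsWithin_stolzRegion hτ one_lt_two
  exact tendsto_nhds_unique (h 2 one_lt_two) (h' 2 one_lt_two)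

theorem horo_le_of_mem_stolzRegion {τ z : ℂ} {M : ℝ} (hz : z ∈ stolzRegion τ M) :
    ‖τ - z‖ ≤ M * (1 - ‖z‖ ^ 2) ∧ horo τ z ≤ M * ‖τ - z‖ := by
  have hz1 := mem_unitDisc.mp hz.1
  have hpos := one_sub_sq_norm_pos hz.1
  have hM : 0 < M := by
    have := (norm_nonneg _).trans_lt hz.2
    exact pos_of_mul_pos_left this (by linarith)
  have h1 : ‖τ - z‖ ≤ M * (1 - ‖z‖ ^ 2) := by
    refine hz.2.le.trans (mul_le_mul_of_nonneg_left ?_ hM.le)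
    nlinarith [norm_nonneg z]
  refine ⟨h1, ?_⟩
  rw [horo, div_le_iff₀ hpos]
  nlinarith [mul_le_mul_of_nonneg_left h1 (norm_nonneg (τ - z))]

theorem IsHolSelfMap.hasAngularLimit_of_horo_le {f : ℂ → ℂ} (hf : IsHolSelfMap f) {τ : ℂ}
    (hτ : ‖τ‖ = 1) (hle : ∀ z ∈ unitDisc, horo τ (f z) ≤ horo τ z) : HasAngularLimit f τ τ := by
  intro M hM
  have h0 : Tendsto (fun z => M * ‖τ - z‖) (𝓝[stolzRegion τ M] τ) (𝓝 0) := by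
    have c : Continuous fun z => M * ‖τ - z‖ := by fun_prop
    simpa using (c.tendsto τ).mono_left (nhdsWithin_le_nhds (s := stolzRegion τ M))
  have h1 : Tendsto (fun z => ‖τ - f z‖ ^ 2) (𝓝[stolzRegion τ M] τ) (𝓝 0) := by
    refine tendsto_of_tendsto_of_tendsto_of_le_of_le' tendsto_const_nhds h0
      (Eventually.of_forall fun z => by positivity)
      (eventually_nhdsWithin_of_forall fun z hz => ?_)
    rw [norm_sub_sq_eq_horo_mul τ (hf.mapsTo hz.1)]
    have h2 := (hle z hz.1).trans (horo_le_of_mem_stolzRegion hz).2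
    nlinarith [horo_pos hτ (hf.mapsTo hz.1), sq_nonneg ‖f z‖]
  have h2 : Tendsto (fun z => ‖τ - f z‖) (𝓝[stolzRegion τ M] τ) (𝓝 0) := by
    simpa [Real.sqrt_sq (norm_nonneg _)] using h1.sqrt
  have h3 := (tendsto_const_nhds (x := τ)).sub (tendsto_zero_iff_norm_tendsto_zero.mpr h2)
  simpa using h3

/-- `G = cayley τ ∘ f - c * cayley τ` has non-negative real part, and by `hinf` a real part at some
`z₀` that is small relative to `(horo τ z₀)⁻¹`. The half-plane Schwarz–Pick lemma spreads this
smallness over the Stolz region, so `(τ - z) * G z` tends to `0`, while `(τ - z) * cayley τ z = τ +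
z` tends to `2 * τ`. -/
theorem IsHolSelfMap.hasAngularLimit_mul_cayley {f : ℂ → ℂ} (hf : IsHolSelfMap f) {τ : ℂ}
    (hτ : ‖τ‖ = 1) {c : ℝ} (hc : 0 ≤ c) (hle : ∀ z ∈ unitDisc, c * horo τ (f z) ≤ horo τ z)
    (hinf : ∀ η > 0, ∃ z ∈ unitDisc, horo τ z ≤ (c + η) * horo τ (f z)) :
    HasAngularLimit (fun z => (τ - z) * cayley τ (f z)) τ (2 * c * τ) := by
  intro M hM
  set G : ℂ → ℂ := fun z => cayley τ (f z) - c * cayley τ z with hG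
  have hGd : DifferentiableOn ℂ G unitDisc :=
    ((differentiableOn_cayley hτ).comp hf.differentiableOn hf.mapsTo).sub
      ((differentiableOn_cayley hτ).const_mul _)
  have hGre : ∀ z, (G z).re = (horo τ (f z))⁻¹ - c * (horo τ z)⁻¹ := fun z => by
    rw [hG, Complex.sub_re, Complex.re_ofReal_mul, cayley_re hτ, cayley_re hτ]
  have hGnn : ∀ z ∈ unitDisc, 0 ≤ (G z).re := fun z hz => by
    have h1 := horo_pos hτ hz
    have h2 := horo_pos hτ (hf.mapsTo hz)
    rw [hGre, sub_nonneg, ← div_eq_mul_inv, div_le_iff₀ h1, ← div_eq_inv_mul, le_div_iff₀ h2]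
    exact hle z hz
  rw [Metric.tendsto_nhds]
  intro ε hε
  have hM0 : 0 < M := by linarith
  set η := ε / (8 * M) with hη
  have hη0 : 0 < η := by positivity
  obtain ⟨z₀, hz₀, hz₀η⟩ := hinf η hη0
  have hd0 := norm_pos_iff.mpr (sub_ne_zero_of_mem_unitDisc hτ hz₀)
  have hGz₀ : (G z₀).re ≤ η * (horo τ z₀)⁻¹ := by
    have h1 := horo_pos hτ hz₀
    have h2 := horo_pos hτ (hf.mapsTo hz₀)
    rw [hGre, sub_le_iff_le_add, ← add_mul, ← div_eq_mul_inv, le_div_iff₀ h1, ← div_eq_inv_mul,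
      div_le_iff₀ h2]
    linarith
  set I := (G z₀).im with hI
  -- A continuous majorant of the error on the Stolz region; its value at `τ` is `4 * η * M = ε /
  -- 2`.
  set B : ℂ → ℝ := fun z => 4 * η * M * ‖1 - conj z₀ * z‖ ^ 2 / ‖τ - z₀‖ ^ 2 +
    ‖τ - z‖ * (|I| + c) with hB
  have hBc : Continuous B := by rw [hB]; fun_prop
  have hBτ : B τ < ε := by
    have e : ‖1 - conj z₀ * τ‖ = ‖τ - z₀‖ := by
      rw [norm_one_sub_conj_mul_comm, norm_one_sub_conj_mul_of_norm_one hτ]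
    simp only [hB, e, sub_self, norm_zero, zero_mul, add_zero]
    rw [mul_div_assoc, div_self (by positivity), hη]
    field_simp
    linarith
  filter_upwards [((hBc.tendsto τ).mono_left nhdsWithin_le_nhds).eventually_lt_const hBτ,
    self_mem_nhdsWithin] with z hzB hz
  rw [dist_eq_norm]
  refine lt_of_le_of_lt ?_ hzB
  have hτz := sub_ne_zero_of_mem_unitDisc hτ hz.1
  have e : (τ - z) * cayley τ (f z) - 2 * c * τ =
      (τ - z) * (G z - I * Complex.I) + (τ - z) * (I * Complex.I - c) := by
    have h1 : (τ - z) * cayley τ z = τ + z := mul_div_cancel₀ _ hτz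
    rw [hG]
    linear_combination (c : ℂ) * h1
  have hI1 : ‖(I : ℂ) * Complex.I - c‖ ≤ |I| + c := by
    refine (norm_sub_le _ _).trans ?_
    rw [norm_mul, Complex.norm_I, mul_one, Complex.norm_real, Complex.norm_real,
      Real.norm_of_nonneg hc, Real.norm_eq_abs]
  have hX : ‖τ - z‖ * ‖G z - I * Complex.I‖ ≤
      4 * η * M * ‖1 - conj z₀ * z‖ ^ 2 / ‖τ - z₀‖ ^ 2 := by
    set ρ := pdist z z₀ with hρ
    have hρ0 : 0 ≤ ρ := pdist_nonneg _ _
    have hρ1 : ρ < 1 := pdist_lt_one hz.1 hz₀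
    have h1 : ‖G z - I * Complex.I‖ * (1 - ρ) ≤ η * (horo τ z₀)⁻¹ * (1 + ρ) :=
      (norm_sub_im_mul_le_of_re_nonneg hGd hGnn hz.1 hz₀).trans
        (mul_le_mul_of_nonneg_right hGz₀ (by linarith))
    have hh0 := inv_pos.mpr (horo_pos hτ hz₀)
    have h2 : ‖G z - I * Complex.I‖ * (1 - ρ ^ 2) ≤ 4 * η * (horo τ z₀)⁻¹ := by
      have h3 := mul_le_mul_of_nonneg_right h1 (show 0 ≤ 1 + ρ by linarith)
      have h4 : (1 + ρ) * (1 + ρ) ≤ 4 := by nlinarith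
      have h5 := mul_le_mul_of_nonneg_left h4 (mul_pos hη0 hh0).le
      linarith
    have hD := norm_one_sub_conj_mul_pos hz.1 hz₀
    have hz1 := one_sub_sq_norm_pos hz.1
    have hz2 := one_sub_sq_norm_pos hz₀
    rw [one_sub_sq_pdist hz.1 hz₀, horo, inv_div, mul_div_assoc', mul_div_assoc',
      div_le_div_iff₀ (by positivity) (by positivity)] at h2
    rw [le_div_iff₀ (by positivity)]
    have h6 : ‖G z - I * Complex.I‖ * (1 - ‖z‖ ^ 2) * ‖τ - z₀‖ ^ 2 ≤
        4 * η * ‖1 - conj z₀ * z‖ ^ 2 :=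
      le_of_mul_le_mul_right (by linarith) hz2
    have h7 := mul_le_mul_of_nonneg_right (horo_le_of_mem_stolzRegion hz).1
      (show 0 ≤ ‖G z - I * Complex.I‖ * ‖τ - z₀‖ ^ 2 by positivity)
    have h8 := mul_le_mul_of_nonneg_left h6 hM0.le
    linarith
  rw [e]
  refine (norm_add_le _ _).trans (add_le_add ?_ ?_)
  · rw [norm_mul]; exact hX
  · rw [norm_mul]; exact mul_le_mul_of_nonneg_left hI1 (norm_nonneg _)

/-- The Julia–Wolff–Carathéodory theorem at a point whose horocycles are invariant. -/
theorem IsHolSelfMap.exists_hasAngularDeriv {f : ℂ → ℂ} (hf : IsHolSelfMap f) {τ : ℂ}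
    (hτ : ‖τ‖ = 1) (hle : ∀ z ∈ unitDisc, horo τ (f z) ≤ horo τ z) :
    ∃ c : ℝ, 1 ≤ c ∧ (∀ z ∈ unitDisc, c * horo τ (f z) ≤ horo τ z) ∧
      HasAngularDeriv f τ (c⁻¹ : ℝ) := by
  have : Nonempty unitDisc := ⟨⟨0, zero_mem_unitDisc⟩⟩
  set q : unitDisc → ℝ := fun z => horo τ z / horo τ (f z) with hq
  have hq1 : ∀ z, 1 ≤ q z := fun z => (one_le_div (horo_pos hτ (hf.mapsTo z.2))).mpr (hle z z.2)
  have hbdd : BddBelow (Set.range q) := ⟨1, by rintro _ ⟨z, rfl⟩; exact hq1 z⟩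
  set c := ⨅ z, q z with hc
  have hc1 : 1 ≤ c := le_ciInf hq1
  have hcle : ∀ z ∈ unitDisc, c * horo τ (f z) ≤ horo τ z := fun z hz =>
    (le_div_iff₀ (horo_pos hτ (hf.mapsTo hz))).mp (ciInf_le hbdd ⟨z, hz⟩)
  have hlim := hf.hasAngularLimit_mul_cayley hτ (by linarith) hcle fun η hη => by
    obtain ⟨z, hz⟩ := exists_lt_of_ciInf_lt (show ⨅ z, q z < c + η by linarith)
    exact ⟨z, z.2, (div_le_iff₀ (horo_pos hτ (hf.mapsTo z.2))).mp hz.le⟩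
  have hlf := hf.hasAngularLimit_of_horo_le hτ hle
  have hτ0 : τ ≠ 0 := norm_ne_zero_iff.mp (by rw [hτ]; exact one_ne_zero)
  have hc0 : (c : ℂ) ≠ 0 := Complex.ofReal_ne_zero.mpr (by linarith)
  -- On the disc this is the difference quotient of `f` at `τ`, rewritten with `cayley`.
  have hquot : HasAngularLimit (fun z => (τ + f z) / ((τ - z) * cayley τ (f z))) τ (c⁻¹ : ℝ) := by
    intro M hM
    have h1 := ((hlf M hM).const_add τ).div (hlim M hM)
      (mul_ne_zero (mul_ne_zero two_ne_zero hc0) hτ0)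
    have e : (τ + τ) / (2 * c * τ) = ((c⁻¹ : ℝ) : ℂ) := by
      push_cast
      field_simp
      ring
    rwa [e] at h1
  refine ⟨c, hc1, hcle, τ, hlf, hquot.congr fun z hz => ?_⟩
  have h1 := sub_ne_zero_of_mem_unitDisc hτ hz
  have h2 := sub_ne_zero_of_mem_unitDisc hτ (hf.mapsTo hz)
  have h3 := add_ne_zero_of_mem_unitDisc hτ (hf.mapsTo hz)
  have h4 : z - τ ≠ 0 := by rw [← neg_sub]; exact neg_ne_zero.mpr h1
  simp only [cayley]
  field_simp
  ring

theorem HasAngularDeriv.unique {f : ℂ → ℂ} {τ d d' : ℂ} (hτ : ‖τ‖ = 1)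
    (h : HasAngularDeriv f τ d) (h' : HasAngularDeriv f τ d') : d = d' := by
  obtain ⟨σ, h1, h2⟩ := h
  obtain ⟨σ', h1', h2'⟩ := h'
  obtain rfl := h1.unique hτ h1'
  exact h2.unique hτ h2'

theorem IsWolffPoint.unique {f : ℂ → ℂ} {τ τ' : ℂ} (h : IsWolffPoint f τ)
    (h' : IsWolffPoint f τ') : τ = τ' :=
  tendsto_nhds_unique (h.2.tendsto_at zero_mem_unitDisc) (h'.2.tendsto_at zero_mem_unitDisc)

/-! ### The hyperbolic step -/

theorem hypDist_eq (z w : ℂ) :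
    hypDist z w = 1 / 2 * Real.log ((1 + pdist z w) / (1 - pdist z w)) := rfl

theorem hypDist_eq_zero {z w : ℂ} (hz : z ∈ unitDisc) (hw : w ∈ unitDisc) :
    hypDist z w = 0 ↔ z = w := by
  constructor
  · intro h
    by_contra hne
    have h0 : 0 < pdist z w :=
      lt_of_le_of_ne (pdist_nonneg z w) (Ne.symm ((pdist_eq_zero hz hw).not.mpr hne))
    have h1 := pdist_lt_one hz hw
    have h2 : 0 < Real.log ((1 + pdist z w) / (1 - pdist z w)) :=
      Real.log_pos ((one_lt_div (by linarith)).mpr (by linarith))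
    rw [hypDist_eq] at h
    linarith
  · rintro rfl
    simp [hypDist_eq]

theorem hypDist_nonneg {z w : ℂ} (hz : z ∈ unitDisc) (hw : w ∈ unitDisc) : 0 ≤ hypDist z w := by
  have h0 := pdist_nonneg z w
  have h1 := pdist_lt_one hz hw
  have h2 : 0 ≤ Real.log ((1 + pdist z w) / (1 - pdist z w)) :=
    Real.log_nonneg ((one_le_div (by linarith)).mpr (by linarith))
  rw [hypDist_eq]
  linarith

/-- The hyperbolic step is read off from any left straightening. -/
theorem IsLeftStraightening.hasHypStep {f h : ℂ → ℂ} (hf : IsHolSelfMap f)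
    (hh : IsLeftStraightening f h) {z : ℂ} (hz : z ∈ unitDisc) :
    HasHypStep f 1 z (hypDist (h z) (h (f z))) := by
  have h1 := hh.tendsto_pdist hf hz (hf.mapsTo hz)
  have h2 := pdist_lt_one (hh.isHolSelfMap.mapsTo hz) (hh.isHolSelfMap.mapsTo (hf.mapsTo hz))
  have h3 := pdist_nonneg (h z) (h (f z))
  have h4 : 1 - pdist (h z) (h (f z)) ≠ 0 := by linarith
  have h5 : (1 + pdist (h z) (h (f z))) / (1 - pdist (h z) (h (f z))) ≠ 0 :=
    div_ne_zero (by linarith) h4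
  exact (((h1.const_add 1).div (h1.const_sub 1) h4).log h5).const_mul (1 / 2)

theorem IsLeftStraightening.hasZeroHypStep_iff {f h : ℂ → ℂ} (hf : IsHolSelfMap f)
    (hh : IsLeftStraightening f h) : HasZeroHypStep f ↔ ∀ z ∈ unitDisc, h z = h (f z) := by
  refine forall₂_congr fun z hz => ?_
  rw [← hypDist_eq_zero (hh.isHolSelfMap.mapsTo hz) (hh.isHolSelfMap.mapsTo (hf.mapsTo hz))]
  exact ⟨fun h0 => tendsto_nhds_unique (hh.hasHypStep hf hz) h0,
    fun h0 => h0 ▸ hh.hasHypStep hf hz⟩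

theorem IsLeftStraightening.hasPosHypStep_iff {f h : ℂ → ℂ} (hf : IsHolSelfMap f)
    (hh : IsLeftStraightening f h) : HasPosHypStep f ↔ ∀ z ∈ unitDisc, h z ≠ h (f z) := by
  refine forall₂_congr fun z hz => ?_
  have h1 := hh.isHolSelfMap.mapsTo hz
  have h2 := hh.isHolSelfMap.mapsTo (hf.mapsTo hz)
  rw [Ne, ← hypDist_eq_zero h1 h2]
  constructor
  · rintro ⟨s, hs, hstep⟩
    rw [tendsto_nhds_unique (hh.hasHypStep hf hz) hstep]
    exact hs.ne'
  · exact fun h0 => ⟨_, lt_of_le_of_ne (hypDist_nonneg h1 h2) (Ne.symm h0), hh.hasHypStep hf hz⟩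

/-! ### Classification -/

theorem IsDiscAut.not_isConstOnDisc {h : ℂ → ℂ} (hh : IsDiscAut h) : ¬ IsConstOnDisc h := by
  rintro ⟨c, hc⟩
  have h1 : (1 / 2 : ℂ) ∈ unitDisc := by rw [mem_unitDisc]; norm_num
  have h2 : (1 / 2 : ℂ) = 0 := hh.bijOn.injOn h1 zero_mem_unitDisc
    ((hc _ h1).trans (hc _ zero_mem_unitDisc).symm)
  norm_num at h2

theorem IsLeftStraightening.not_isConstOnDisc_of_horo {f h : ℂ → ℂ} (hf : IsHolSelfMap f)
    (hh : IsLeftStraightening f h) {τ : ℂ} (hτ : ‖τ‖ = 1) {c : ℝ} (hc : 1 < c)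
    (hle : ∀ z ∈ unitDisc, c * horo τ (f z) ≤ horo τ z) : ¬ IsConstOnDisc h := by
  rintro ⟨a, ha⟩
  have h0 := zero_mem_unitDisc
  have hlim := hh.tendsto_pdist hf h0 (hf.mapsTo h0)
  rw [ha _ h0, ha _ (hf.mapsTo h0), pdist_self] at hlim
  have := ge_of_tendsto' (hlim.mul_const (c + 1)) fun n => by
    have hn := (hf.iterate n).mapsTo h0
    rw [← Function.iterate_succ_apply, Function.iterate_succ_apply']
    exact sub_one_le_pdist_mul_of_mul_horo_le hτ hn (hf.mapsTo hn) (hle _ hn)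
  linarith

/-- The classification of fixed-point-free maps in terms of the constancy of a left straightening. -/
theorem IsLeftStraightening.isParabolicMap_or_isHyperbolicMap {f h : ℂ → ℂ} (hf : IsHolSelfMap f)
    (hna : ¬ IsDiscAut f) (hfix : ∀ z ∈ unitDisc, f z ≠ z) (hh : IsLeftStraightening f h) :
    IsParabolicMap f ∨ (IsHyperbolicMap f ∧ ¬ IsConstOnDisc h) := by
  obtain ⟨τ, hτ, hle⟩ := hf.exists_isWolffPoint hna hfix
  obtain ⟨c, hc1, hcle, hd⟩ := hf.exists_hasAngularDeriv hτ.1 hle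
  rcases hc1.eq_or_lt with rfl | hc
  · exact Or.inl ⟨hf, hna, hfix, τ, hτ, by simpa using hd⟩
  · exact Or.inr ⟨⟨hf, hna, hfix, τ, hτ, c⁻¹, inv_pos.mpr (by linarith), inv_lt_one_of_one_lt₀ hc,
      hd⟩, hh.not_isConstOnDisc_of_horo hf hτ.1 hc hcle⟩

/-- Uniqueness of the Wolff point and of the angular derivative identifies the given `d < 1` with
`c⁻¹`, so `c > 1`. -/
theorem IsLeftStraightening.not_isConstOnDisc_of_isHyperbolicMap {f h : ℂ → ℂ}
    (hh : IsLeftStraightening f h) (hyp : IsHyperbolicMap f) : ¬ IsConstOnDisc h := by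
  obtain ⟨hf, hna, hfix, τ, hτ, d, hd0, hd1, hd⟩ := hyp
  obtain ⟨τ', hτ', hle⟩ := hf.exists_isWolffPoint hna hfix
  obtain rfl := hτ.unique hτ'
  obtain ⟨c, hc1, hcle, hdc⟩ := hf.exists_hasAngularDeriv hτ.1 hle
  have hdc' : d = c⁻¹ := Complex.ofReal_injective (hd.unique hτ.1 hdc)
  refine hh.not_isConstOnDisc_of_horo hf hτ.1 (lt_of_le_of_ne hc1 ?_) hcle
  rintro rfl
  rw [inv_one] at hdc'
  exact hd1.ne hdc'

theorem mainTheorem12 (f : ℂ → ℂ) (hf : IsHolSelfMap f) :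
    (∃ h : ℂ → ℂ, IsLeftStraightening f h) ∧
    ∀ h : ℂ → ℂ, IsLeftStraightening f h →
      (IsDiscAut f ↔ IsDiscAut h) ∧
      ((IsEllipticMap f ∨ (IsParabolicMap f ∧ HasZeroHypStep f)) ↔ IsConstOnDisc h) ∧
      ((IsHyperbolicMap f ∨ (IsParabolicMap f ∧ HasPosHypStep f)) ↔
        (¬ IsConstOnDisc h ∧ ¬ IsDiscAut h)) := by
  refine ⟨exists_isLeftStraightening hf, fun h hh => ?_⟩
  have hi := hh.isDiscAut_iff hf
  refine ⟨hi, ⟨?_, fun hconst => ?_⟩, ⟨?_, ?_⟩⟩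
  · rintro (⟨-, hna, p, hp, hfp⟩ | ⟨⟨-, -, hfix, -⟩, hzero⟩)
    · exact hh.isConstOnDisc_of_fixed hf hna hp hfp
    · by_contra hconst
      exact hh.apply_ne hf hfix hconst zero_mem_unitDisc
        ((hh.hasZeroHypStep_iff hf).mp hzero 0 zero_mem_unitDisc).symm
  · have hna : ¬ IsDiscAut f := fun hfa => (hi.mp hfa).not_isConstOnDisc hconst
    by_cases hfix : ∃ z ∈ unitDisc, f z = z
    · exact Or.inl ⟨hf, hna, hfix⟩
    · push Not at hfix
      rcases hh.isParabolicMap_or_isHyperbolicMap hf hna hfix with hpar | ⟨-, hnc⟩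
      · obtain ⟨c, hc⟩ := hconst
        exact Or.inr ⟨hpar, (hh.hasZeroHypStep_iff hf).mpr fun z hz =>
          (hc z hz).trans (hc _ (hf.mapsTo hz)).symm⟩
      · exact absurd hconst hnc
  · rintro (hyp | ⟨⟨-, hna, -⟩, hpos⟩)
    · exact ⟨hh.not_isConstOnDisc_of_isHyperbolicMap hyp, hi.not.mp hyp.2.1⟩
    · refine ⟨fun ⟨c, hc⟩ => ?_, hi.not.mp hna⟩
      exact (hh.hasPosHypStep_iff hf).mp hpos 0 zero_mem_unitDisc
        ((hc _ zero_mem_unitDisc).trans (hc _ (hf.mapsTo zero_mem_unitDisc)).symm)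
  · rintro ⟨hconst, hha⟩
    have hna := hi.not.mpr hha
    have hfix : ∀ z ∈ unitDisc, f z ≠ z := fun z hz hfz =>
      hconst (hh.isConstOnDisc_of_fixed hf hna hz hfz)
    rcases hh.isParabolicMap_or_isHyperbolicMap hf hna hfix with hpar | ⟨hyp, -⟩
    · exact Or.inr ⟨hpar, (hh.hasPosHypStep_iff hf).mpr fun z hz =>
        (hh.apply_ne hf hfix hconst hz).symm⟩
    · exact Or.inl hyp
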